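/- Let a stationary, axisymmetric, circular spacetime be given in Hartle–Thorne type coordinates $(t,r,\theta,\phi)$, $r>r_H$, by $$ds^2=-N^2dt^2+A^2dr^2+r^2B^2\left\{d\theta^2+\sin^2\theta\,(d\phi-\omega\,dt)^2\right\},$$ where $N,A,B>0$ and $\omega$ are functions of $(r,\theta)$, of class $C^2$ for $r>r_H$ (including on the symmetry axis). Assume: 1. *(Reflection symmetry)* $g_{\mu\nu}(r,\theta)=g_{\mu\nu}(r,\pi-\theta)$. 2. *(Asymptotically mass centred coordinates)* $N,A,B,\omega$ have smooth expansions in powers of $1/r$ near spatial infinity (as functions of $(1/r,\theta)$ they extend smoothly to $1/r=0$), and, uniformly in $\theta$, $B=1+O(r^{-2})$, $N=1-\frac Mr+O(r^{-2})$, $A=1+\frac Mr+O(r^{-2})$, $\omega=\frac{2J}{r^3}+O(r^{-4})$, where $M$ is the mass and $J$ the angular momentum. 3. *(BH or NS)* Either (black hole) $r_H>0$ and $r=r_H$ is a horizon with constant angular velocity $\Omega_H$: as $r\to r_H$, uniformly in $\theta$, $N\to0$, $\omega\to\Omega_H$, and $r^2B^2$ stays bounded; or (neutron star) $r_H=0$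 and $r=0$ is a regular centre: as $r\to0$, uniformly in $\theta$, $N$ has a positive limit, $A$ and $B$ have the same positive limit, and $\omega$ has a limit. Call a function $f(r,\theta)$ *regular* if it is $C^2$ for $r>r_H$ (including on the axis) and $f$ and $g^{\mu\nu}\partial_\mu f\,\partial_\nu f$ are bounded as $r\to r_H$. Let $\mathcal R_{GB}=R^2-4R_{\mu\nu}R^{\mu\nu}+R_{\alpha\beta\gamma\delta}R^{\alpha\beta\gamma\delta}$. Then: (i) $\mathcal R_{GB}(r,\theta)=\mathcal R_{GB}(r,\pi-\theta)$ for all $r>r_H$, $0<\theta<\pi$. (ii) Every regular solution $\phi_0(r,\theta)$ of $\Box\phi_0=0$ such that $\phi_0/r$ has a smooth expansion in powers of $1/r$ and $\phi_0=r\cos\theta\,\bigl[1+\frac{\phi_1(\theta)}{r}\bigr]+O(r^{-1})$ uniformly in $\theta$, for some function $\phi_1$, satisfies $\phi_0(r,\pi-\theta)=-\phi_0(r,\theta)$. (iii) Let $\epsilon\in\mathbb R$ and let $\Phi(r,\theta)$ be a regular solution of the shift-symmetric scalar Gauss–Bonnet scalar equation $\Box\Phi+\epsilon\,\mathcal R_{GB}=0$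 with a smooth expansion in powers of $1/r$, $\Phi=\frac{\mu_1(\theta)}{r}+\frac{\mu_2(\theta)}{r^2}+O(r^{-3})$ uniformly in $\theta$. Then the monopole hair $\mu_1(\theta)=\mu_1$ is constant, $\mu_2(\theta)=M\mu_1+\mu_{(2,1)}\cos\theta$, where $$\mu_{(2,1)}=\frac32\int_0^\pi\mu_2(\theta)\cos\theta\sin\theta\,d\theta$$ is the $\ell=1$ mode of the dipole hair, and $\mu_{(2,1)}=0$. Hence, uniformly in $\theta$, $$\Phi(r,\theta)=\frac{\mu_1}{r}+\frac{M\mu_1}{r^2}+O(r^{-3}).$$ The result is exact in $\epsilon$ (no perturbative expansion is made), and holds for both neutron-star and black-hole spacetimes. -/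

import Mathlib

open Filter Topology Set Asymptotics

noncomputable section

namespace SGB

/-! ### Lorentzian geometry in a coordinate chart of dimension four -/

/-- Partial derivative of `f` with respect to the coordinate `x^μ`. -/
def pd (μ : Fin 4) (f : (Fin 4 → ℝ) → ℝ) (x : Fin 4 → ℝ) : ℝ :=
  deriv (fun s => f (Function.update x μ s)) (x μ)

/-- A metric in a chart: its matrix of components `g_{μν}` at each coordinate point. -/
abbrev MetricField := (Fin 4 → ℝ) → Matrix (Fin 4) (Fin 4) ℝ

/-- Christoffel symbols of the Levi-Civita connection, `Γ^l_{mn}`. -/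
def christoffel (g : MetricField) (l m n : Fin 4) (x : Fin 4 → ℝ) : ℝ :=
  (1 / 2) * ∑ s, (g x)⁻¹ l s *
    (pd m (fun y => g y s n) x + pd n (fun y => g y s m) x - pd s (fun y => g y m n) x)

/-- Riemann tensor `R^a_{bmn}`. -/
def riemann (g : MetricField) (a b m n : Fin 4) (x : Fin 4 → ℝ) : ℝ :=
  pd m (christoffel g a n b) x - pd n (christoffel g a m b) x
    + ∑ l, (christoffel g a m l x * christoffel g l n b x
        - christoffel g a n l x * christoffel g l m b x)

/-- Ricci tensor `R_{bn} = R^a_{ban}`. -/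
def ricci (g : MetricField) (b n : Fin 4) (x : Fin 4 → ℝ) : ℝ :=
  ∑ a, riemann g a b a n x

/-- Ricci scalar `R = g^{bn} R_{bn}`. -/
def ricciScalar (g : MetricField) (x : Fin 4 → ℝ) : ℝ :=
  ∑ b, ∑ n, (g x)⁻¹ b n * ricci g b n x

/-- `R_{μν} R^{μν}`. -/
def ricciSq (g : MetricField) (x : Fin 4 → ℝ) : ℝ :=
  ∑ a, ∑ b, ∑ c, ∑ d, (g x)⁻¹ a c * (g x)⁻¹ b d * ricci g a b x * ricci g c d x

/-- `R_{αβγδ} R^{αβγδ} = g_{ae} g^{bf} g^{cp} g^{dq} R^a_{bcd} R^e_{fpq}`. -/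
def riemannSq (g : MetricField) (x : Fin 4 → ℝ) : ℝ :=
  ∑ a, ∑ b, ∑ c, ∑ d, ∑ e, ∑ f, ∑ p, ∑ q,
    g x a e * (g x)⁻¹ b f * (g x)⁻¹ c p * (g x)⁻¹ d q *
      riemann g a b c d x * riemann g e f p q x

/-- The Gauss–Bonnet invariant `R² - 4 R_{μν} R^{μν} + R_{αβγδ} R^{αβγδ}`. -/
def gaussBonnet (g : MetricField) (x : Fin 4 → ℝ) : ℝ :=
  ricciScalar g x ^ 2 - 4 * ricciSq g x + riemannSq g x

/-- The wave operator `□ f = |det g|^{-1/2} ∂_μ (|det g|^{1/2} g^{μν} ∂_ν f)`. -/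
def box (g : MetricField) (f : (Fin 4 → ℝ) → ℝ) (x : Fin 4 → ℝ) : ℝ :=
  (Real.sqrt |(g x).det|)⁻¹ *
    ∑ m, pd m (fun y => Real.sqrt |(g y).det| * ∑ n, (g y)⁻¹ m n * pd n f y) x

/-! ### Hartle–Thorne type coordinates `(t, r, θ, φ)` -/

/-- The metric functions of a stationary, axisymmetric and circular spacetime, as functions of
`(r, θ)`. -/
structure MetricFunctions where
  N : ℝ → ℝ → ℝ
  A : ℝ → ℝ → ℝ
  B : ℝ → ℝ → ℝ
  ω : ℝ → ℝ → ℝ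

/-- `ds² = -N² dt² + A² dr² + r² B² (dθ² + sin² θ (dφ - ω dt)²)`; the coordinates
`x 0, x 1, x 2, x 3` are `t, r, θ, φ`. -/
def MetricFunctions.metric (h : MetricFunctions) : MetricField := fun x =>
  let r := x 1
  let θ := x 2
  let P := r ^ 2 * h.B r θ ^ 2 * Real.sin θ ^ 2
  !![-h.N r θ ^ 2 + P * h.ω r θ ^ 2, 0, 0, -P * h.ω r θ;
     0, h.A r θ ^ 2, 0, 0;
     0, 0, r ^ 2 * h.B r θ ^ 2, 0;
     -P * h.ω r θ, 0, 0, P]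

/-- A stationary and axisymmetric scalar, seen as a function on the chart. -/
def onChart (f : ℝ → ℝ → ℝ) : (Fin 4 → ℝ) → ℝ := fun x => f (x 1) (x 2)

/-- The polar angle ranges over `[0, π]`; a function of `(r, θ)` is extended to all real `θ` as an
even `2π`-periodic function. It then defines a `C²` function of the point of three-space with polar
coordinates `(r, θ, φ)`, on the symmetry axis included, exactly when the extension is `C²`. -/
structure IsRegularOutside (rH : ℝ) (f : ℝ → ℝ → ℝ) : Prop where
  contDiffOn : ContDiffOn ℝ 2 (fun p : ℝ × ℝ => f p.1 p.2) (Ioi rH ×ˢ univ)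
  even : ∀ r > rH, ∀ θ, f r (-θ) = f r θ
  periodic : ∀ r > rH, ∀ θ, f r (θ + 2 * Real.pi) = f r θ

/-- `f` admits a smooth expansion in powers of `1/r` near spatial infinity: as a function of
`(1/r, θ)` it extends smoothly to `1/r = 0`. -/
def SmoothAtInfinity (f : ℝ → ℝ → ℝ) : Prop :=
  ∃ δ > 0, ∃ F : ℝ × ℝ → ℝ, ContDiffOn ℝ (⊤ : ℕ∞) F (Ioo (-δ) δ ×ˢ univ) ∧
    ∀ r > δ⁻¹, ∀ θ, f r θ = F (r⁻¹, θ)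

/-- `f(r, θ) = O(r^{-n})` as `r → ∞`, uniformly in `θ`. -/
def IsBigOInv (n : ℕ) (f : ℝ → ℝ → ℝ) : Prop :=
  (fun p : ℝ × ℝ => f p.1 p.2) =O[atTop ×ˢ (⊤ : Filter ℝ)] fun p => (p.1 ^ n)⁻¹

/-- The functions define a Lorentzian metric of class `C²` on the region `r > rH`. -/
structure MetricFunctions.IsSpacetime (h : MetricFunctions) (rH : ℝ) : Prop where
  regN : IsRegularOutside rH h.N
  regA : IsRegularOutside rH h.A
  regB : IsRegularOutside rH h.B
  regω : IsRegularOutside rH h.ω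
  posN : ∀ r > rH, ∀ θ, 0 < h.N r θ
  posA : ∀ r > rH, ∀ θ, 0 < h.A r θ
  posB : ∀ r > rH, ∀ θ, 0 < h.B r θ

/-- Reflection symmetry of the metric, `g_{μν}(r, θ) = g_{μν}(r, π - θ)`. -/
def MetricFunctions.IsReflectionSymmetric (h : MetricFunctions) (rH : ℝ) : Prop :=
  ∀ t φ : ℝ, ∀ r > rH, ∀ θ ∈ Ioo 0 Real.pi,
    h.metric ![t, r, θ, φ] = h.metric ![t, r, Real.pi - θ, φ]

/-- The coordinates are asymptotically mass centred, with mass `M` and angular momentum `J`. -/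
structure MetricFunctions.IsAMC (h : MetricFunctions) (M J : ℝ) : Prop where
  smoothN : SmoothAtInfinity h.N
  smoothA : SmoothAtInfinity h.A
  smoothB : SmoothAtInfinity h.B
  smoothω : SmoothAtInfinity h.ω
  expandB : IsBigOInv 2 fun r θ => h.B r θ - 1
  expandN : IsBigOInv 2 fun r θ => h.N r θ - (1 - M / r)
  expandA : IsBigOInv 2 fun r θ => h.A r θ - (1 + M / r)
  expandω : IsBigOInv 4 fun r θ => h.ω r θ - 2 * J / r ^ 3

/-- The approach to the inner end `r → rH` of the region, uniformly in `θ`. -/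
def innerEnd (rH : ℝ) : Filter (ℝ × ℝ) := 𝓝[>] rH ×ˢ (⊤ : Filter ℝ)

/-- Black hole: the region `r > rH` ends at an event horizon. There the generator
`X = ∂_t + ΩH ∂_φ` becomes null and orthogonal to the rotational Killing field, that is `N → 0` and
`ω → ΩH` for a constant `ΩH`, while the sections of constant `r` do not blow up. -/
structure MetricFunctions.IsBlackHole (h : MetricFunctions) (rH : ℝ) : Prop where
  pos : 0 < rH
  lapse : Tendsto (fun p : ℝ × ℝ => h.N p.1 p.2) (innerEnd rH) (𝓝 0)
  angular : ∃ ΩH : ℝ, Tendsto (fun p : ℝ × ℝ => h.ω p.1 p.2) (innerEnd rH) (𝓝 ΩH)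
  area : (fun p : ℝ × ℝ => p.1 ^ 2 * h.B p.1 p.2 ^ 2) =O[innerEnd rH] fun _ => (1 : ℝ)

/-- Neutron star: there is no horizon, and `r = 0` is a regular centre, at which the metric has a
continuous nondegenerate limit. -/
structure MetricFunctions.IsNeutronStar (h : MetricFunctions) (rH : ℝ) : Prop where
  zero : rH = 0
  lapse : ∃ c > 0, Tendsto (fun p : ℝ × ℝ => h.N p.1 p.2) (innerEnd rH) (𝓝 c)
  spatial : ∃ a > 0, Tendsto (fun p : ℝ × ℝ => h.A p.1 p.2) (innerEnd rH) (𝓝 a) ∧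
    Tendsto (fun p : ℝ × ℝ => h.B p.1 p.2) (innerEnd rH) (𝓝 a)
  angular : ∃ w : ℝ, Tendsto (fun p : ℝ × ℝ => h.ω p.1 p.2) (innerEnd rH) (𝓝 w)

/-- `f` is regular at the horizon (at the centre, for a star): `f` and the scalar
`g^{μν} ∂_μ f ∂_ν f = A⁻² (∂_r f)² + (r B)⁻² (∂_θ f)²` stay bounded. Every `f` with a `C¹` extension
through the horizon or the centre, in coordinates in which the metric is regular there, satisfies
this. -/
structure MetricFunctions.IsRegularInside (h : MetricFunctions) (rH : ℝ) (f : ℝ → ℝ → ℝ) :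
    Prop where
  bounded : (fun p : ℝ × ℝ => f p.1 p.2) =O[innerEnd rH] fun _ => (1 : ℝ)
  gradient : (fun p : ℝ × ℝ =>
      (deriv (fun s => f s p.2) p.1 / h.A p.1 p.2) ^ 2 +
        (deriv (fun s => f p.1 s) p.2 / (p.1 * h.B p.1 p.2)) ^ 2)
      =O[innerEnd rH] fun _ => (1 : ℝ)

/-- The scalar field of shift-symmetric scalar Gauss–Bonnet theory with coupling `ε`: a stationary
axisymmetric scalar, regular on the axis and at the horizon or centre, that solves
`□Φ + ε R_GB = 0` and has the expansion `μ₁(θ)/r + μ₂(θ)/r² + O(r^{-3})` near spatial infinity, with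
monopole hair `μ₁(θ)` and dipole hair `μ₂(θ)`. -/
structure MetricFunctions.IsSGBScalar (h : MetricFunctions) (rH ε : ℝ) (Φ : ℝ → ℝ → ℝ)
    (μ₁ μ₂ : ℝ → ℝ) : Prop where
  regular : IsRegularOutside rH Φ
  inside : h.IsRegularInside rH Φ
  equation : ∀ t φ : ℝ, ∀ r > rH, ∀ θ ∈ Ioo 0 Real.pi,
    box h.metric (onChart Φ) ![t, r, θ, φ] + ε * gaussBonnet h.metric ![t, r, θ, φ] = 0
  smooth : SmoothAtInfinity Φ
  expand : IsBigOInv 3 fun r θ => Φ r θ - (μ₁ θ / r + μ₂ θ / r ^ 2)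

/-- The homogeneous solution `φ₀`: a stationary axisymmetric solution of `□φ₀ = 0`, regular on the
axis and at the horizon or centre, with `φ₀ = r P₁(cos θ) (1 + φ₁(θ)/r) + O(r^{-1})` near spatial
infinity for some function `φ₁`; here `P₁(x) = x`. -/
structure MetricFunctions.IsHomogeneousSolution (h : MetricFunctions) (rH : ℝ)
    (φ₀ : ℝ → ℝ → ℝ) : Prop where
  regular : IsRegularOutside rH φ₀
  inside : h.IsRegularInside rH φ₀
  equation : ∀ t φ : ℝ, ∀ r > rH, ∀ θ ∈ Ioo 0 Real.pi,
    box h.metric (onChart φ₀) ![t, r, θ, φ] = 0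
  smooth : SmoothAtInfinity fun r θ => φ₀ r θ / r
  expand : ∃ φ₁ : ℝ → ℝ, IsBigOInv 1 fun r θ => φ₀ r θ - r * Real.cos θ * (1 + φ₁ θ / r)

/-- The `ℓ = 1` mode of a function on the sphere that depends on `θ` only: its coefficient along
`P₁(cos θ) = cos θ` in the expansion in Legendre polynomials of `cos θ`. -/
def modeOne (f : ℝ → ℝ) : ℝ :=
  (3 / 2) * ∫ θ in (0 : ℝ)..Real.pi, f θ * Real.cos θ * Real.sin θ

end SGB

end

/-! On functions of `(r, θ)` the frame dragging `ω` drops out of the wave operator: up to the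
positive density it is the divergence-form operator `waveOp`, with coefficients `N r²B²/A` and `N A`
(`box_onChart`). Everything rests on a uniqueness theorem for `waveOp`, on reflection symmetry, and
on the two lowest orders of the expansion in `1/r`.

Uniqueness (`eq_zero_of_waveOp_eq_zero`): let `χ` be a regular solution that decays at infinity. The
flux of `χ ∇χ` through the sphere of radius `r` is nondecreasing in `r`, its derivative being the
Dirichlet energy on that sphere. The flux is `O(1/r)` at infinity. It tends to zero at the inner
end, because `χ` and `∂_r χ / A` are bounded while `N r²B²` tends to zero at a horizon as well as at
a centre. So the flux vanishes, hence the energy, hence `∂_r χ`, and decay gives `χ = 0`.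

Reflection: `θ ↦ π - θ` is an isometry, so the Gauss–Bonnet invariant is even and solutions are
mapped to solutions. The difference of `Φ` and its mirror image is a decaying homogeneous solution,
so `Φ` is even. In the sum of `φ₀` and its mirror image the terms linear in `r` cancel. The constant
term is harmonic on the sphere, hence constant, and it vanishes on the equator; uniqueness then
makes `φ₀` odd.

Asymptotics: smooth expansions may be differentiated term by term, and `HasLead` records their
leading terms. The leading part of the curvature is that of flat space, which is zero, so the source
does not reach the orders `1/r` and `1/r²` of the scalar equation. On `r^k c(θ)` the operator gives
`r^k (k(k+1) c sin θ + (sin θ c')')` to leading order. At `k = -1`, `μ₁` is harmonic on the sphere,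
hence constant. At `k = -2`, after `μ₁/r` is subtracted with its mass correction, `μ₂ - M μ₁` is a
Legendre eigenfunction of degree one, so a multiple of `cos θ`; evenness of `Φ` makes the multiple
zero. The coupling `ε` only multiplies an even, rapidly decaying source, so no expansion in `ε` is
needed. -/

noncomputable section

namespace SGB

/-! ### The inverse metric and the wave operator -/

/-- The components `g^{μν}` of the inverse metric. -/
def MetricFunctions.metricInv (h : MetricFunctions) : MetricField := fun x =>
  let r := x 1
  let θ := x 2
  let P := r ^ 2 * h.B r θ ^ 2 * Real.sin θ ^ 2
  !![-(h.N r θ ^ 2)⁻¹, 0, 0, -(h.ω r θ * (h.N r θ ^ 2)⁻¹);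
     0, (h.A r θ ^ 2)⁻¹, 0, 0;
     0, 0, (r ^ 2 * h.B r θ ^ 2)⁻¹, 0;
     -(h.ω r θ * (h.N r θ ^ 2)⁻¹), 0, 0, P⁻¹ + -(h.ω r θ * h.ω r θ * (h.N r θ ^ 2)⁻¹)]

theorem MetricFunctions.metric_inv (h : MetricFunctions) (x : Fin 4 → ℝ)
    (hN : h.N (x 1) (x 2) ≠ 0) (hA : h.A (x 1) (x 2) ≠ 0) (hB : h.B (x 1) (x 2) ≠ 0)
    (hr : x 1 ≠ 0) (hs : Real.sin (x 2) ≠ 0) : (h.metric x)⁻¹ = h.metricInv x := by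
  apply Matrix.inv_eq_right_inv
  ext i j
  fin_cases i <;> fin_cases j <;>
    simp [MetricFunctions.metric, MetricFunctions.metricInv, Matrix.mul_apply,
      Fin.sum_univ_succ] <;> field_simp <;> ring

theorem MetricFunctions.metric_det (h : MetricFunctions) (x : Fin 4 → ℝ) :
    (h.metric x).det = -(h.N (x 1) (x 2) * h.A (x 1) (x 2) *
      (x 1 ^ 2 * h.B (x 1) (x 2) ^ 2) * Real.sin (x 2)) ^ 2 := by
  simp [MetricFunctions.metric, Matrix.det_succ_row_zero, Fin.sum_univ_succ, Fin.succAbove]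
  ring

/-- The coefficient of `sin θ ∂_r f` in the radial flux. -/
def MetricFunctions.radialCoeff (h : MetricFunctions) (r θ : ℝ) : ℝ :=
  h.N r θ * (r ^ 2 * h.B r θ ^ 2) / h.A r θ

/-- The coefficient of `sin θ ∂_θ f` in the angular flux. -/
def MetricFunctions.angularCoeff (h : MetricFunctions) (r θ : ℝ) : ℝ := h.N r θ * h.A r θ

/-- The wave operator on functions of `(r, θ)`, multiplied by the density `|det g|^{1/2}`. -/
def MetricFunctions.waveOp (h : MetricFunctions) (f : ℝ → ℝ → ℝ) (r θ : ℝ) : ℝ :=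
  deriv (fun s => h.radialCoeff s θ * deriv (fun s' => f s' θ) s) r * Real.sin θ +
    deriv (fun τ => h.angularCoeff r τ * Real.sin τ * deriv (fun τ' => f r τ') τ) θ

/-- Since `∂_t f = ∂_φ f = 0` and the inverse metric mixes only `t` with `φ`, just the diagonal
entries `g^{rr}` and `g^{θθ}` contribute, and neither contains `ω`. -/
theorem MetricFunctions.flux (h : MetricFunctions) (f : ℝ → ℝ → ℝ) (y : Fin 4 → ℝ)
    (hN : 0 < h.N (y 1) (y 2)) (hA : 0 < h.A (y 1) (y 2)) (hB : 0 < h.B (y 1) (y 2))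
    (hr : 0 < y 1) (hs : 0 < Real.sin (y 2)) (m : Fin 4) :
    Real.sqrt |(h.metric y).det| * ∑ n, (h.metric y)⁻¹ m n * pd n (onChart f) y =
      ![0, h.radialCoeff (y 1) (y 2) * deriv (fun s => f s (y 2)) (y 1) * Real.sin (y 2),
        h.angularCoeff (y 1) (y 2) * Real.sin (y 2) * deriv (fun s => f (y 1) s) (y 2), 0] m := by
  rw [h.metric_inv y hN.ne' hA.ne' hB.ne' hr.ne' hs.ne', h.metric_det, abs_neg,
    abs_of_nonneg (sq_nonneg _), Real.sqrt_sq (by positivity)]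
  fin_cases m <;> simp [Fin.sum_univ_succ, MetricFunctions.metricInv, pd, onChart,
    MetricFunctions.radialCoeff, MetricFunctions.angularCoeff]
  · field_simp
  · field_simp

theorem MetricFunctions.box_onChart (h : MetricFunctions) {rH : ℝ} (h0 : 0 ≤ rH)
    (hs : h.IsSpacetime rH) (f : ℝ → ℝ → ℝ) (t φ : ℝ) {r θ : ℝ} (hr : rH < r)
    (hθ : θ ∈ Ioo 0 Real.pi) :
    box h.metric (onChart f) ![t, r, θ, φ] =
      (h.N r θ * h.A r θ * (r ^ 2 * h.B r θ ^ 2) * Real.sin θ)⁻¹ * h.waveOp f r θ := by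
  have hflux : ∀ y : Fin 4 → ℝ, rH < y 1 → y 2 ∈ Ioo 0 Real.pi → ∀ m, _ := fun y h1 h2 =>
    h.flux f y (hs.posN _ h1 _) (hs.posA _ h1 _) (hs.posB _ h1 _) (h0.trans_lt h1)
      (Real.sin_pos_of_mem_Ioo h2)
  have hN := hs.posN r hr θ
  have hA := hs.posA r hr θ
  have hsin := Real.sin_pos_of_mem_Ioo hθ
  have hB := hs.posB r hr θ
  have hr0 : 0 < r := h0.trans_lt hr
  unfold box
  rw [h.metric_det, abs_neg, abs_of_nonneg (sq_nonneg _)]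
  simp only [Matrix.cons_val_one, Matrix.cons_val_zero, Matrix.cons_val]
  rw [Real.sqrt_sq (by positivity)]
  congr 1
  -- The flux formula needs `r > rH` and `0 < θ < π`. These persist for all `t`, `φ` but only near
  -- the given `r`, `θ`, which is enough for derivatives.
  have e0 : ∀ᶠ s in 𝓝 t, Real.sqrt |(h.metric (Function.update ![t, r, θ, φ] 0 s)).det| *
      ∑ n, (h.metric (Function.update ![t, r, θ, φ] 0 s))⁻¹ 0 n *
        pd n (onChart f) (Function.update ![t, r, θ, φ] 0 s) = 0 :=
    Eventually.of_forall fun s => by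
      rw [hflux _ (by simpa using hr) (by simpa using hθ)]; simp
  have e3 : ∀ᶠ s in 𝓝 φ, Real.sqrt |(h.metric (Function.update ![t, r, θ, φ] 3 s)).det| *
      ∑ n, (h.metric (Function.update ![t, r, θ, φ] 3 s))⁻¹ 3 n *
        pd n (onChart f) (Function.update ![t, r, θ, φ] 3 s) = 0 :=
    Eventually.of_forall fun s => by
      rw [hflux _ (by simpa using hr) (by simpa using hθ)]; simp
  have e1 : ∀ᶠ s in 𝓝 r, Real.sqrt |(h.metric (Function.update ![t, r, θ, φ] 1 s)).det| *
      ∑ n, (h.metric (Function.update ![t, r, θ, φ] 1 s))⁻¹ 1 n *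
        pd n (onChart f) (Function.update ![t, r, θ, φ] 1 s) =
      h.radialCoeff s θ * deriv (fun s' => f s' θ) s * Real.sin θ := by
    filter_upwards [lt_mem_nhds hr] with s hsr
    rw [hflux _ (by simpa using hsr) (by simpa using hθ)]; simp
  have e2 : ∀ᶠ s in 𝓝 θ, Real.sqrt |(h.metric (Function.update ![t, r, θ, φ] 2 s)).det| *
      ∑ n, (h.metric (Function.update ![t, r, θ, φ] 2 s))⁻¹ 2 n *
        pd n (onChart f) (Function.update ![t, r, θ, φ] 2 s) =
      h.angularCoeff r s * Real.sin s * deriv (fun s' => f r s') s := by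
    filter_upwards [isOpen_Ioo.mem_nhds hθ] with s hsr
    rw [hflux _ (by simpa using hr) (by simpa using hsr)]; simp
  rw [Fin.sum_univ_four]
  unfold pd at e0 e1 e2 e3 ⊢
  simp only [Matrix.cons_val_one, Matrix.cons_val_zero, Matrix.cons_val] at e0 e1 e2 e3 ⊢
  rw [EventuallyEq.deriv_eq e0, EventuallyEq.deriv_eq e1, EventuallyEq.deriv_eq e2,
    EventuallyEq.deriv_eq e3]
  simp [MetricFunctions.waveOp, deriv_mul_const_field]

/-! ### Reflection in the equatorial plane -/

/-- The reflection `θ ↦ π - θ` of the chart. -/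
def reflect (x : Fin 4 → ℝ) : Fin 4 → ℝ := Function.update x 2 (Real.pi - x 2)

/-- The eigenvalue of the coordinate direction `∂_μ` under the reflection. -/
def reflectSign : Fin 4 → ℝ := ![1, 1, -1, 1]

theorem reflectSign_mul_self (m : Fin 4) : reflectSign m * reflectSign m = 1 := by
  fin_cases m <;> simp [reflectSign]

/-- The part `r > rH`, `0 < θ < π` of the chart. -/
def chartDomain (rH : ℝ) : Set (Fin 4 → ℝ) := {x | rH < x 1 ∧ x 2 ∈ Ioo 0 Real.pi}

theorem isOpen_chartDomain (rH : ℝ) : IsOpen (chartDomain rH) :=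
  (isOpen_lt continuous_const (continuous_apply 1)).inter
    (isOpen_Ioo.preimage (continuous_apply 2))

theorem reflect_mem_chartDomain {rH : ℝ} {x : Fin 4 → ℝ} (hx : x ∈ chartDomain rH) :
    reflect x ∈ chartDomain rH := by
  obtain ⟨h1, h2, h3⟩ := hx
  refine ⟨by simpa [reflect] using h1, ?_, ?_⟩ <;> simp [reflect] <;> linarith

/-- The chain rule: only `∂_θ` changes sign. The parity `c` is arbitrary so that the lemma applies
to the metric components and again to the Christoffel symbols. -/
theorem pd_reflect {rH : ℝ} {f : (Fin 4 → ℝ) → ℝ} {c : ℝ}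
    (hf : ∀ y ∈ chartDomain rH, f (reflect y) = c * f y) (m : Fin 4) {x : Fin 4 → ℝ}
    (hx : x ∈ chartDomain rH) : pd m f (reflect x) = reflectSign m * c * pd m f x := by
  have hev : ∀ᶠ s in 𝓝 (x m), f (reflect (Function.update x m s)) =
      c * f (Function.update x m s) := by
    have hc : Continuous fun s => Function.update x m s := continuous_const.update m continuous_id
    have := hc.continuousAt.preimage_mem_nhds (x := x m) (t := chartDomain rH)
      (by simpa using (isOpen_chartDomain rH).mem_nhds hx)
    filter_upwards [this] with s hs using hf _ hs
  by_cases hm : m = 2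
  · subst hm
    have hupd : ∀ s, Function.update (reflect x) 2 s =
        reflect (Function.update x 2 (Real.pi - s)) := fun s => by
      simp [reflect]
    have : pd 2 f (reflect x) =
        deriv (fun s => f (reflect (Function.update x 2 (Real.pi - s)))) (Real.pi - x 2) := by
      simp only [pd, hupd]
      simp [reflect]
    rw [this, deriv_comp_const_sub (f := fun s => f (reflect (Function.update x 2 s))),
      sub_sub_cancel, EventuallyEq.deriv_eq hev, deriv_const_mul_field']
    simp [reflectSign, pd]
  · have hupd : ∀ s, Function.update (reflect x) m s = reflect (Function.update x m s) := fun s => by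
      simp only [reflect]
      rw [Function.update_comm hm, Function.update_of_ne (Ne.symm hm)]
    have h1 : reflectSign m = 1 := by
      fin_cases m <;> simp_all [reflectSign]
    simp only [pd, hupd]
    rw [show reflect x m = x m by simp [reflect, Function.update_of_ne hm],
      EventuallyEq.deriv_eq hev, deriv_const_mul_field', h1, one_mul]

/-- The reflection acts on coordinate directions by signs, so a component picks up the signs of its
free indices; a summed index contributes a square, which is one. -/
theorem christoffel_reflect
    (hg : ∀ x ∈ chartDomain rH, ∀ a b, g (reflect x) a b = reflectSign a * reflectSign b * g x a b)
    (hgi : ∀ x ∈ chartDomain rH, ∀ a b,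
      (g (reflect x))⁻¹ a b = reflectSign a * reflectSign b * (g x)⁻¹ a b)
    (l m n : Fin 4) {x : Fin 4 → ℝ} (hx : x ∈ chartDomain rH) :
    christoffel g l m n (reflect x) =
      (reflectSign l * reflectSign m * reflectSign n) * christoffel g l m n x := by
  have hp : ∀ k a b, pd k (fun y => g y a b) (reflect x) =
      reflectSign k * (reflectSign a * reflectSign b) * pd k (fun y => g y a b) x :=
    fun k a b => pd_reflect (f := fun y => g y a b) (fun y hy => hg y hy a b) k hx
  simp only [christoffel, hp, hgi x hx]
  rw [mul_left_comm, Finset.mul_sum (a := _ * _ * _)]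
  congr 1
  refine Finset.sum_congr rfl fun s _ => ?_
  linear_combination (reflectSign l * reflectSign m * reflectSign n * (g x)⁻¹ l s *
    (pd m (fun y => g y s n) x + pd n (fun y => g y s m) x - pd s (fun y => g y m n) x)) *
      reflectSign_mul_self s

theorem riemann_reflect
    (hg : ∀ x ∈ chartDomain rH, ∀ a b, g (reflect x) a b = reflectSign a * reflectSign b * g x a b)
    (hgi : ∀ x ∈ chartDomain rH, ∀ a b,
      (g (reflect x))⁻¹ a b = reflectSign a * reflectSign b * (g x)⁻¹ a b)
    (a b m n : Fin 4) {x : Fin 4 → ℝ} (hx : x ∈ chartDomain rH) :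
    riemann g a b m n (reflect x) =
      (reflectSign a * reflectSign b * reflectSign m * reflectSign n) * riemann g a b m n x := by
  have hC : ∀ l m n, ∀ y ∈ chartDomain rH, christoffel g l m n (reflect y) =
      (reflectSign l * reflectSign m * reflectSign n) * christoffel g l m n y :=
    fun l m n y hy => christoffel_reflect hg hgi l m n hy
  simp only [riemann, pd_reflect (hC _ _ _) _ hx, hC _ _ _ x hx]
  rw [mul_add, Finset.mul_sum]
  congr 1
  · ring
  refine Finset.sum_congr rfl fun s _ => ?_
  linear_combination (reflectSign a * reflectSign b * reflectSign m * reflectSign n) *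
    (christoffel g a m s x * christoffel g s n b x
        - christoffel g a n s x * christoffel g s m b x) * reflectSign_mul_self s

theorem ricci_reflect
    (hg : ∀ x ∈ chartDomain rH, ∀ a b, g (reflect x) a b = reflectSign a * reflectSign b * g x a b)
    (hgi : ∀ x ∈ chartDomain rH, ∀ a b,
      (g (reflect x))⁻¹ a b = reflectSign a * reflectSign b * (g x)⁻¹ a b)
    (b n : Fin 4) {x : Fin 4 → ℝ} (hx : x ∈ chartDomain rH) :
    ricci g b n (reflect x) = (reflectSign b * reflectSign n) * ricci g b n x := by
  simp only [ricci, riemann_reflect hg hgi _ _ _ _ hx]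
  rw [Finset.mul_sum]
  refine Finset.sum_congr rfl fun s _ => ?_
  linear_combination (reflectSign b * reflectSign n * riemann g s b s n x) *
    reflectSign_mul_self s

/-- In a full contraction every index occurs twice, so all signs cancel in pairs. -/
theorem gaussBonnet_reflect
    (hg : ∀ x ∈ chartDomain rH, ∀ a b, g (reflect x) a b = reflectSign a * reflectSign b * g x a b)
    (hgi : ∀ x ∈ chartDomain rH, ∀ a b,
      (g (reflect x))⁻¹ a b = reflectSign a * reflectSign b * (g x)⁻¹ a b)
    {x : Fin 4 → ℝ} (hx : x ∈ chartDomain rH) :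
    gaussBonnet g (reflect x) = gaussBonnet g x := by
  have hs := reflectSign_mul_self
  have h1 : ricciScalar g (reflect x) = ricciScalar g x := by
    simp only [ricciScalar, ricci_reflect hg hgi _ _ hx, hgi x hx]
    refine Finset.sum_congr rfl fun b _ => Finset.sum_congr rfl fun n _ => ?_
    calc _ = (reflectSign b * reflectSign b) * (reflectSign n * reflectSign n) *
          ((g x)⁻¹ b n * ricci g b n x) := by ring
      _ = _ := by rw [hs, hs]; ring
  have h2 : ricciSq g (reflect x) = ricciSq g x := by
    simp only [ricciSq, ricci_reflect hg hgi _ _ hx, hgi x hx]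
    refine Finset.sum_congr rfl fun a _ => Finset.sum_congr rfl fun b _ =>
      Finset.sum_congr rfl fun c _ => Finset.sum_congr rfl fun d _ => ?_
    calc _ = (reflectSign a * reflectSign a) * (reflectSign b * reflectSign b) *
          (reflectSign c * reflectSign c) * (reflectSign d * reflectSign d) *
          ((g x)⁻¹ a c * (g x)⁻¹ b d * ricci g a b x * ricci g c d x) := by ring
      _ = _ := by rw [hs, hs, hs, hs]; ring
  have h3 : riemannSq g (reflect x) = riemannSq g x := by
    simp only [riemannSq, riemann_reflect hg hgi _ _ _ _ hx, hgi x hx, hg x hx]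
    refine Finset.sum_congr rfl fun a _ => Finset.sum_congr rfl fun b _ =>
      Finset.sum_congr rfl fun c _ => Finset.sum_congr rfl fun d _ =>
      Finset.sum_congr rfl fun e _ => Finset.sum_congr rfl fun f _ =>
      Finset.sum_congr rfl fun p _ => Finset.sum_congr rfl fun q _ => ?_
    calc _ = (reflectSign a * reflectSign a) * (reflectSign b * reflectSign b) *
          (reflectSign c * reflectSign c) * (reflectSign d * reflectSign d) *
          ((reflectSign e * reflectSign e) * (reflectSign f * reflectSign f) *
          (reflectSign p * reflectSign p) * (reflectSign q * reflectSign q)) *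
          (g x a e * (g x)⁻¹ b f * (g x)⁻¹ c p * (g x)⁻¹ d q *
            riemann g a b c d x * riemann g e f p q x) := by ring
      _ = _ := by simp only [hs]; ring
  rw [gaussBonnet, gaussBonnet, h1, h2, h3]

/-- Reflection symmetry of the metric functions in the open range of the polar angle. -/
theorem MetricFunctions.IsReflectionSymmetric.eq_of_mem_Ioo {h : MetricFunctions} {rH : ℝ}
    (h0 : 0 ≤ rH) (hs : h.IsSpacetime rH) (hrefl : h.IsReflectionSymmetric rH) {r θ : ℝ}
    (hr : rH < r) (hθ : θ ∈ Ioo 0 Real.pi) :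
    h.N r (Real.pi - θ) = h.N r θ ∧ h.A r (Real.pi - θ) = h.A r θ ∧
      h.B r (Real.pi - θ) = h.B r θ ∧ h.ω r (Real.pi - θ) = h.ω r θ := by
  have e := hrefl 0 0 r hr θ hθ
  have hr0 : r ≠ 0 := (h0.trans_lt hr).ne'
  have hsin := (Real.sin_pos_of_mem_Ioo hθ).ne'
  have e11 := congrFun (congrFun e 1) 1
  have e22 := congrFun (congrFun e 2) 2
  have e03 := congrFun (congrFun e 0) 3
  have e00 := congrFun (congrFun e 0) 0
  simp only [MetricFunctions.metric, Matrix.of_apply, Matrix.cons_val_one, Matrix.cons_val_zero,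
    Matrix.cons_val, Real.sin_pi_sub] at e11 e22 e03 e00
  -- `g_rr` and `g_θθ` give `A` and `B`; only then does `g_tφ` give `ω`, and `g_tt` gives `N`.
  -- Positivity selects the square roots.
  have hA : h.A r (Real.pi - θ) = h.A r θ :=
    ((sq_eq_sq₀ (hs.posA r hr _).le (hs.posA r hr _).le).1 e11).symm
  have hB : h.B r (Real.pi - θ) = h.B r θ :=
    ((sq_eq_sq₀ (hs.posB r hr _).le (hs.posB r hr _).le).1
      (mul_left_cancel₀ (pow_ne_zero 2 hr0) e22)).symm
  have hω : h.ω r (Real.pi - θ) = h.ω r θ := by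
    rw [hB] at e03
    have hB0 := (hs.posB r hr θ).ne'
    exact (mul_left_cancel₀ (neg_ne_zero.2 (by positivity)) e03).symm
  refine ⟨((sq_eq_sq₀ (hs.posN r hr _).le (hs.posN r hr _).le).1 ?_).symm, hA, hB, hω⟩
  rw [hB, hω] at e00
  linarith

theorem MetricFunctions.gaussBonnet_symm {h : MetricFunctions} {rH : ℝ} (h0 : 0 ≤ rH)
    (hs : h.IsSpacetime rH) (hrefl : h.IsReflectionSymmetric rH) (t φ : ℝ) {r θ : ℝ}
    (hr : rH < r) (hθ : θ ∈ Ioo 0 Real.pi) :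
    gaussBonnet h.metric ![t, r, θ, φ] = gaussBonnet h.metric ![t, r, Real.pi - θ, φ] := by
  have hx : (![t, r, θ, φ] : Fin 4 → ℝ) ∈ chartDomain rH := ⟨by simpa using hr, by simpa using hθ⟩
  have hrf : reflect ![t, r, θ, φ] = ![t, r, Real.pi - θ, φ] := by
    ext i; fin_cases i <;> simp [reflect]
  rw [← hrf]
  refine (gaussBonnet_reflect ?_ ?_ hx).symm
  · intro x ⟨h1, h2⟩ a b
    obtain ⟨eN, eA, eB, eω⟩ := hrefl.eq_of_mem_Ioo h0 hs h1 h2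
    fin_cases a <;> fin_cases b <;>
      simp [MetricFunctions.metric, reflect, reflectSign, eN, eA, eB, eω]
  · intro x hx a b
    have ⟨h1, h2⟩ := hx
    have ⟨h1', h2'⟩ := reflect_mem_chartDomain hx
    obtain ⟨eN, eA, eB, eω⟩ := hrefl.eq_of_mem_Ioo h0 hs h1 h2
    rw [h.metric_inv _ (hs.posN _ h1 _).ne' (hs.posA _ h1 _).ne' (hs.posB _ h1 _).ne'
        (h0.trans_lt h1).ne' (Real.sin_pos_of_mem_Ioo h2).ne',
      h.metric_inv _ (hs.posN _ h1' _).ne' (hs.posA _ h1' _).ne' (hs.posB _ h1' _).ne'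
        (h0.trans_lt h1').ne' (Real.sin_pos_of_mem_Ioo h2').ne']
    fin_cases a <;> fin_cases b <;>
      simp [MetricFunctions.metricInv, reflect, reflectSign, eN, eA, eB, eω]

/-! ### Integrals depending on a parameter, and smooth division -/

section Parametric

set_option linter.unusedSectionVars false

variable {H : Type} [NormedAddCommGroup H] [NormedSpace ℝ H] [ProperSpace H]
  {E : Type} [NormedAddCommGroup E] [NormedSpace ℝ E]

/-- Compactness supplies the constant dominating function used for continuity and differentiation
under the integral sign. -/
theorem exists_ball_bound {K : ℝ × H → E} {V : Set (ℝ × H)} (hK : ContinuousOn K V)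
    {U : Set H} (hU : IsOpen U) {a b : ℝ} (hV : uIcc a b ×ˢ U ⊆ V) {p : H} (hp : p ∈ U) :
    ∃ ε > 0, Metric.ball p ε ⊆ U ∧ ∃ C, ∀ s ∈ uIcc a b, ∀ x ∈ Metric.ball p ε, ‖K (s, x)‖ ≤ C := by
  obtain ⟨ε, hε, hsub⟩ := Metric.nhds_basis_closedBall.mem_iff.1 (hU.mem_nhds hp)
  have hc : IsCompact (uIcc a b ×ˢ Metric.closedBall p ε) :=
    isCompact_uIcc.prod (isCompact_closedBall p ε)
  obtain ⟨C, hC⟩ := hc.exists_bound_of_continuousOn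
    (hK.mono ((prod_mono subset_rfl hsub).trans hV))
  exact ⟨ε, hε, Metric.ball_subset_closedBall.trans hsub, C, fun s hs x hx =>
    hC (s, x) ⟨hs, Metric.ball_subset_closedBall hx⟩⟩

theorem continuousOn_slice {K : ℝ × H → E} {V : Set (ℝ × H)} (hK : ContinuousOn K V)
    {U : Set H} {a b : ℝ} (hV : uIcc a b ×ˢ U ⊆ V) {p : H} (hp : p ∈ U) :
    ContinuousOn (fun s => K (s, p)) (uIcc a b) :=
  hK.comp (by fun_prop) fun s hs => hV ⟨hs, hp⟩

theorem aestronglyMeasurable_slice {K : ℝ × H → E} {V : Set (ℝ × H)} (hK : ContinuousOn K V)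
    {U : Set H} {a b : ℝ} (hV : uIcc a b ×ˢ U ⊆ V) {p : H} (hp : p ∈ U) :
    MeasureTheory.AEStronglyMeasurable (fun s => K (s, p))
      (MeasureTheory.volume.restrict (uIoc a b)) :=
  (intervalIntegrable_iff.1
    (continuousOn_slice hK hV hp).intervalIntegrable).aestronglyMeasurable

theorem continuousOn_parametric_integral {K : ℝ × H → E} {V : Set (ℝ × H)}
    (hK : ContinuousOn K V) {U : Set H} (hU : IsOpen U) {a b : ℝ} (hVo : IsOpen V)
    (hV : uIcc a b ×ˢ U ⊆ V) :
    ContinuousOn (fun p => ∫ s in a..b, K (s, p)) U := by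
  intro p hp
  refine ContinuousAt.continuousWithinAt ?_
  obtain ⟨ε, hε, hsub, C, hC⟩ := exists_ball_bound hK hU hV hp
  refine intervalIntegral.continuousAt_of_dominated_interval (bound := fun _ => C) ?_ ?_
    intervalIntegrable_const ?_
  · filter_upwards [hU.mem_nhds hp] with x hx using aestronglyMeasurable_slice hK hV hx
  · filter_upwards [Metric.ball_mem_nhds p hε] with x hx
    exact Eventually.of_forall fun s hs => hC s (uIoc_subset_uIcc hs) x hx
  · refine Eventually.of_forall fun s hs => ?_
    have := hK.continuousAt (hVo.mem_nhds (hV (mk_mem_prod (uIoc_subset_uIcc hs) hp)))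
    exact ContinuousAt.comp' (f := fun x => (s, x)) this (by fun_prop)

theorem hasFDerivAt_parametric_integral {K : ℝ × H → E} {V : Set (ℝ × H)}
    (hK : ContDiffOn ℝ 1 K V) {U : Set H} (hU : IsOpen U) {a b : ℝ} (hVo : IsOpen V)
    (hV : uIcc a b ×ˢ U ⊆ V) {p : H} (hp : p ∈ U) :
    HasFDerivAt (fun p => ∫ s in a..b, K (s, p))
      (∫ s in a..b, (fderiv ℝ K (s, p)).comp (ContinuousLinearMap.inr ℝ ℝ H)) p := by
  have hK' : ContinuousOn (fun q => (fderiv ℝ K q).comp (ContinuousLinearMap.inr ℝ ℝ H)) V :=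
    (hK.continuousOn_fderiv_of_isOpen hVo le_rfl).clm_comp continuousOn_const
  obtain ⟨ε, hε, hsub, C, hC⟩ := exists_ball_bound hK' hU hV hp
  refine intervalIntegral.hasFDerivAt_integral_of_dominated_of_fderiv_le
    (bound := fun _ => C) (F := fun p s => K (s, p))
    (F' := fun p s => (fderiv ℝ K (s, p)).comp (ContinuousLinearMap.inr ℝ ℝ H))
    (Metric.ball_mem_nhds p hε) ?_ ?_ ?_ ?_ intervalIntegrable_const ?_
  · filter_upwards [hU.mem_nhds hp] with x hx using
      aestronglyMeasurable_slice hK.continuousOn hV hx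
  · exact (continuousOn_slice hK.continuousOn hV hp).intervalIntegrable
  · exact aestronglyMeasurable_slice hK' hV hp
  · exact Eventually.of_forall fun s hs x hx => hC s (uIoc_subset_uIcc hs) x hx
  · refine Eventually.of_forall fun s hs x hx => ?_
    have h1 : HasFDerivAt K (fderiv ℝ K (s, x)) (s, x) :=
      ((hK.differentiableOn one_ne_zero).differentiableAt
        (hVo.mem_nhds (hV ⟨uIoc_subset_uIcc hs, hsub hx⟩))).hasFDerivAt
    exact h1.comp x (hasFDerivAt_prodMk_right s x)

end Parametric

/-- Induction on `n` by differentiating under the integral. The target space is quantified after `n`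
because the derivative takes values in a space of linear maps. -/
theorem contDiffOn_parametric_integral {H : Type} [NormedAddCommGroup H] [NormedSpace ℝ H]
    [ProperSpace H] {V : Set (ℝ × H)} (hVo : IsOpen V) {U : Set H} (hU : IsOpen U) {a b : ℝ}
    (hV : uIcc a b ×ˢ U ⊆ V) (n : ℕ) :
    ∀ {E : Type} [NormedAddCommGroup E] [NormedSpace ℝ E] {K : ℝ × H → E},
      ContDiffOn ℝ n K V → ContDiffOn ℝ n (fun p => ∫ s in a..b, K (s, p)) U := by
  induction n with
  | zero =>
    intro E _ _ K hK
    exact contDiffOn_zero.2 (continuousOn_parametric_integral hK.continuousOn hU hVo hV)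
  | succ n ih =>
    intro E _ _ K hK
    have hK1 : ContDiffOn ℝ 1 K V := hK.of_le (by exact_mod_cast Nat.le_add_left 1 n)
    have hder := fun p (hp : p ∈ U) => hasFDerivAt_parametric_integral hK1 hU hVo hV hp
    push_cast
    rw [contDiffOn_succ_iff_fderiv_of_isOpen hU]
    refine ⟨fun p hp => (hder p hp).differentiableAt.differentiableWithinAt, by simp, ?_⟩
    refine ContDiffOn.congr (ih (K := fun q =>
      (fderiv ℝ K q).comp (ContinuousLinearMap.inr ℝ ℝ H)) ?_) fun p hp => (hder p hp).fderiv
    exact (hK.fderiv_of_isOpen hVo (by push_cast; exact le_rfl)).clm_comp contDiffOn_const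

/-- A strip around `u = 0` in the `(u, θ)` plane. -/
def strip (δ : ℝ) : Set (ℝ × ℝ) := Ioo (-δ) δ ×ˢ univ

theorem isOpen_strip (δ : ℝ) : IsOpen (strip δ) := isOpen_Ioo.prod isOpen_univ

/-- A smooth function vanishing on the line `u = 0` is divisible by `u`. -/
theorem exists_smooth_div {δ : ℝ} {F : ℝ × ℝ → ℝ}
    (hF : ContDiffOn ℝ (⊤ : ℕ∞) F (strip δ)) (h0 : ∀ θ, F (0, θ) = 0) :
    ∃ G : ℝ × ℝ → ℝ, ContDiffOn ℝ (⊤ : ℕ∞) G (strip δ) ∧ ∀ p ∈ strip δ, F p = p.1 * G p := by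
  have hFd : ∀ p ∈ strip δ, HasFDerivAt F (fderiv ℝ F p) p := fun p hp =>
    ((hF.differentiableOn (by simp)).differentiableAt ((isOpen_strip δ).mem_nhds hp)).hasFDerivAt
  -- Hadamard's formula `F(u, θ) = u ∫₀¹ ∂_u F(s u, θ) ds`. The integrand is smooth on the open set
  -- `V` of points that `φ` sends into the strip.
  set φ : ℝ × (ℝ × ℝ) → ℝ × ℝ := fun q => (q.1 * q.2.1, q.2.2) with hφ
  have hφc : ContDiff ℝ (⊤ : ℕ∞) φ := by fun_prop
  set V : Set (ℝ × (ℝ × ℝ)) := φ ⁻¹' strip δ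
  have hVo : IsOpen V := (isOpen_strip δ).preimage hφc.continuous
  have hV : uIcc (0 : ℝ) 1 ×ˢ strip δ ⊆ V := by
    rintro ⟨s, u, θ⟩ ⟨hs, hu, -⟩
    rw [uIcc_of_le zero_le_one] at hs
    refine ⟨?_, trivial⟩
    have : |u| < δ := abs_lt.2 hu
    have : |s * u| < δ := by
      rw [abs_mul, abs_of_nonneg hs.1]
      exact (mul_le_of_le_one_left (abs_nonneg u) hs.2).trans_lt this
    exact abs_lt.1 this
  set K : ℝ × (ℝ × ℝ) → ℝ := fun q => fderiv ℝ F (φ q) (1, 0)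
  have hK : ContDiffOn ℝ (⊤ : ℕ∞) K V :=
    ((hF.fderiv_of_isOpen (isOpen_strip δ) (m := (⊤ : ℕ∞)) (by simp)).comp hφc.contDiffOn
      fun q hq => hq).clm_apply contDiffOn_const
  refine ⟨fun p => ∫ s in (0 : ℝ)..1, K (s, p), ?_, ?_⟩
  · rw [contDiffOn_infty]
    exact fun n => contDiffOn_parametric_integral hVo (isOpen_strip δ) hV n
      (hK.of_le (by exact_mod_cast le_top))
  · rintro ⟨u, θ⟩ hp
    have hd : ∀ s ∈ uIcc (0 : ℝ) 1, HasDerivAt (fun s => F (s * u, θ)) (u * K (s, (u, θ))) s := by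
      intro s hs
      have h1 := hFd _ (hV (show (s, (u, θ)) ∈ _ from ⟨hs, hp⟩))
      have h2 : HasDerivAt (fun s : ℝ => (s * u, θ)) (u, 0) s := by
        simpa using ((hasDerivAt_id s).mul_const u).prodMk (hasDerivAt_const s θ)
      have h3 := h1.comp_hasDerivAt s h2
      have h4 : fderiv ℝ F (φ (s, u, θ)) (u, 0) = u * K (s, (u, θ)) := by
        rw [show ((u, 0) : ℝ × ℝ) = u • (1, 0) by simp, map_smul, smul_eq_mul]
      exact h4 ▸ h3
    have hi : IntervalIntegrable (fun s => u * K (s, (u, θ))) MeasureTheory.volume 0 1 :=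
      ((continuousOn_slice hK.continuousOn hV hp).const_smul u).intervalIntegrable
    have := intervalIntegral.integral_eq_sub_of_hasDerivAt hd hi
    simp only [one_mul, zero_mul, h0, sub_zero, intervalIntegral.integral_const_mul] at this
    exact this.symm

/-! ### Partial derivatives of functions of two variables -/

section Partial

variable {f : ℝ → ℝ → ℝ} {U : Set (ℝ × ℝ)}

theorem hasDerivAt_fst (hU : IsOpen U) {n : WithTop ℕ∞} (hn : n ≠ 0)
    (hf : ContDiffOn ℝ n (fun p : ℝ × ℝ => f p.1 p.2) U) {x y : ℝ} (hp : (x, y) ∈ U) :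
    HasDerivAt (fun s => f s y) (fderiv ℝ (fun p : ℝ × ℝ => f p.1 p.2) (x, y) (1, 0)) x := by
  have h1 := ((hf.differentiableOn hn).differentiableAt (hU.mem_nhds hp)).hasFDerivAt
  exact h1.comp_hasDerivAt x ((hasDerivAt_id x).prodMk (hasDerivAt_const x y))

theorem hasDerivAt_snd (hU : IsOpen U) {n : WithTop ℕ∞} (hn : n ≠ 0)
    (hf : ContDiffOn ℝ n (fun p : ℝ × ℝ => f p.1 p.2) U) {x y : ℝ} (hp : (x, y) ∈ U) :
    HasDerivAt (fun s => f x s) (fderiv ℝ (fun p : ℝ × ℝ => f p.1 p.2) (x, y) (0, 1)) y := by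
  have h1 := ((hf.differentiableOn hn).differentiableAt (hU.mem_nhds hp)).hasFDerivAt
  exact h1.comp_hasDerivAt y ((hasDerivAt_const y x).prodMk (hasDerivAt_id y))

theorem contDiffOn_deriv_fst (hU : IsOpen U) {n m : WithTop ℕ∞} (hmn : m + 1 ≤ n)
    (hf : ContDiffOn ℝ n (fun p : ℝ × ℝ => f p.1 p.2) U) :
    ContDiffOn ℝ m (fun p : ℝ × ℝ => deriv (fun s => f s p.2) p.1) U := by
  have hn : n ≠ 0 := by rintro rfl; simp at hmn
  exact ((hf.fderiv_of_isOpen hU hmn).clm_apply contDiffOn_const).congr fun p hp =>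
    (hasDerivAt_fst hU hn hf hp).deriv

theorem contDiffOn_deriv_snd (hU : IsOpen U) {n m : WithTop ℕ∞} (hmn : m + 1 ≤ n)
    (hf : ContDiffOn ℝ n (fun p : ℝ × ℝ => f p.1 p.2) U) :
    ContDiffOn ℝ m (fun p : ℝ × ℝ => deriv (fun s => f p.1 s) p.2) U := by
  have hn : n ≠ 0 := by rintro rfl; simp at hmn
  exact ((hf.fderiv_of_isOpen hU hmn).clm_apply contDiffOn_const).congr fun p hp =>
    (hasDerivAt_snd hU hn hf hp).deriv

theorem hasDerivAt_deriv_fst (hU : IsOpen U) {n : WithTop ℕ∞} (hn : n ≠ 0)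
    (hf : ContDiffOn ℝ n (fun p : ℝ × ℝ => f p.1 p.2) U) {x y : ℝ} (hp : (x, y) ∈ U) :
    HasDerivAt (fun s => f s y) (deriv (fun s => f s y) x) x :=
  (hasDerivAt_fst hU hn hf hp).differentiableAt.hasDerivAt

theorem hasDerivAt_deriv_snd (hU : IsOpen U) {n : WithTop ℕ∞} (hn : n ≠ 0)
    (hf : ContDiffOn ℝ n (fun p : ℝ × ℝ => f p.1 p.2) U) {x y : ℝ} (hp : (x, y) ∈ U) :
    HasDerivAt (fun s => f x s) (deriv (fun s => f x s) y) y :=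
  (hasDerivAt_snd hU hn hf hp).differentiableAt.hasDerivAt

end Partial

/-- Every angle is `± arccos (cos θ)` modulo `2π`, so such a function is determined by its values on
`[0, π]`. -/
theorem eq_arccos_cos_of_even_periodic {f : ℝ → ℝ} (he : ∀ θ, f (-θ) = f θ)
    (hp : ∀ θ, f (θ + 2 * Real.pi) = f θ) (θ : ℝ) : f θ = f (Real.arccos (Real.cos θ)) := by
  have hc : Real.cos (Real.arccos (Real.cos θ)) = Real.cos θ :=
    Real.cos_arccos (Real.neg_one_le_cos θ) (Real.cos_le_one θ)
  have hper : Function.Periodic f (2 * Real.pi) := hp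
  obtain ⟨k, hk | hk⟩ := Real.cos_eq_cos_iff.1 hc
  · calc f θ = f (Real.arccos (Real.cos θ) + k * (2 * Real.pi)) := by
          congr 1; linarith
      _ = _ := hper.int_mul k _
  · calc f θ = f (-Real.arccos (Real.cos θ) + k * (2 * Real.pi)) := by
          congr 1; linarith
      _ = _ := (hper.int_mul k _).trans (he _)

/-- Two continuous even `2π`-periodic functions that agree on `(0, π)` are equal. -/
theorem eq_of_even_periodic {f g : ℝ → ℝ} (hf : Continuous f) (hg : Continuous g)
    (hfe : ∀ θ, f (-θ) = f θ) (hfp : ∀ θ, f (θ + 2 * Real.pi) = f θ)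
    (hge : ∀ θ, g (-θ) = g θ) (hgp : ∀ θ, g (θ + 2 * Real.pi) = g θ)
    (h : ∀ θ ∈ Ioo 0 Real.pi, f θ = g θ) (θ : ℝ) : f θ = g θ := by
  rw [eq_arccos_cos_of_even_periodic hfe hfp, eq_arccos_cos_of_even_periodic hge hgp]
  have hcl : closure (Ioo 0 Real.pi) ⊆ {x | f x = g x} :=
    closure_minimal h (isClosed_eq hf hg)
  rw [closure_Ioo Real.pi_pos.ne] at hcl
  exact hcl ⟨Real.arccos_nonneg _, Real.arccos_le_pi _⟩

theorem isOpen_outside (rH : ℝ) : IsOpen (Ioi rH ×ˢ (univ : Set ℝ)) := isOpen_Ioi.prod isOpen_univ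

theorem IsRegularOutside.continuous {rH : ℝ} {f : ℝ → ℝ → ℝ} (hf : IsRegularOutside rH f) {r : ℝ}
    (hr : rH < r) : Continuous (f r) :=
  continuousOn_univ.1 (hf.contDiffOn.continuousOn.comp (f := fun θ : ℝ => (r, θ)) (by fun_prop)
    fun θ _ => ⟨hr, trivial⟩)

theorem IsRegularOutside.comp_pi_sub {rH : ℝ} {f : ℝ → ℝ → ℝ} (hf : IsRegularOutside rH f) :
    IsRegularOutside rH fun r θ => f r (Real.pi - θ) where
  contDiffOn := hf.contDiffOn.comp (f := fun p : ℝ × ℝ => (p.1, Real.pi - p.2)) (by fun_prop)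
    fun p hp => ⟨hp.1, trivial⟩
  even r hr θ := by
    rw [← hf.even r hr, ← hf.periodic r hr]
    congr 1; ring
  periodic r hr θ := by
    rw [← hf.periodic r hr]
    congr 1; ring

theorem IsRegularOutside.add {rH : ℝ} {f g : ℝ → ℝ → ℝ} (hf : IsRegularOutside rH f)
    (hg : IsRegularOutside rH g) : IsRegularOutside rH fun r θ => f r θ + g r θ where
  contDiffOn := hf.contDiffOn.add hg.contDiffOn
  even r hr θ := by rw [hf.even r hr, hg.even r hr]
  periodic r hr θ := by rw [hf.periodic r hr, hg.periodic r hr]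

theorem IsRegularOutside.neg {rH : ℝ} {f : ℝ → ℝ → ℝ} (hf : IsRegularOutside rH f) :
    IsRegularOutside rH fun r θ => -f r θ where
  contDiffOn := hf.contDiffOn.neg
  even r hr θ := by rw [hf.even r hr]
  periodic r hr θ := by rw [hf.periodic r hr]

/-! ### The coefficients of the wave operator -/

section Coefficients

variable {h : MetricFunctions} {rH : ℝ}

theorem MetricFunctions.IsSpacetime.contDiffOn_radialCoeff (hs : h.IsSpacetime rH) :
    ContDiffOn ℝ 2 (fun p : ℝ × ℝ => h.radialCoeff p.1 p.2) (Ioi rH ×ˢ univ) := by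
  refine ((hs.regN.contDiffOn.mul ((contDiffOn_fst.pow 2).mul (hs.regB.contDiffOn.pow 2))).div
    hs.regA.contDiffOn ?_)
  exact fun p hp => (hs.posA _ hp.1 _).ne'

theorem MetricFunctions.IsSpacetime.contDiffOn_angularCoeff (hs : h.IsSpacetime rH) :
    ContDiffOn ℝ 2 (fun p : ℝ × ℝ => h.angularCoeff p.1 p.2) (Ioi rH ×ˢ univ) :=
  hs.regN.contDiffOn.mul hs.regA.contDiffOn

theorem MetricFunctions.IsSpacetime.radialCoeff_pos (h0 : 0 ≤ rH) (hs : h.IsSpacetime rH)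
    {r : ℝ} (hr : rH < r) (θ : ℝ) : 0 < h.radialCoeff r θ := by
  have := hs.posN r hr θ
  have := hs.posA r hr θ
  have := hs.posB r hr θ
  have : 0 < r := h0.trans_lt hr
  unfold MetricFunctions.radialCoeff
  positivity

theorem MetricFunctions.IsSpacetime.angularCoeff_pos (hs : h.IsSpacetime rH)
    {r : ℝ} (hr : rH < r) (θ : ℝ) : 0 < h.angularCoeff r θ :=
  mul_pos (hs.posN r hr θ) (hs.posA r hr θ)

theorem MetricFunctions.inner_nonneg (hinner : h.IsBlackHole rH ∨ h.IsNeutronStar rH) :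
    0 ≤ rH := by
  rcases hinner with hb | hn
  · exact hb.pos.le
  · exact hn.zero.ge

/-- The two cases merge here: at a horizon `N → 0` with bounded area factor, at a centre `r² → 0`
with `N` and `B` convergent. This is what removes the inner boundary term of the energy identity. -/
theorem MetricFunctions.tendsto_inner_flux (hinner : h.IsBlackHole rH ∨ h.IsNeutronStar rH) :
    Tendsto (fun p : ℝ × ℝ => h.N p.1 p.2 * (p.1 ^ 2 * h.B p.1 p.2 ^ 2)) (innerEnd rH) (𝓝 0) := by
  rcases hinner with hb | hn
  · have := (isBigO_refl (fun p : ℝ × ℝ => h.N p.1 p.2) (innerEnd rH)).mul hb.area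
    exact this.trans_tendsto (by simpa using hb.lapse)
  · obtain ⟨c, -, hc⟩ := hn.lapse
    obtain ⟨a, -, -, ha⟩ := hn.spatial
    have h1 : Tendsto (fun p : ℝ × ℝ => p.1) (innerEnd rH) (𝓝 rH) :=
      tendsto_fst.mono_right nhdsWithin_le_nhds
    have := hc.mul ((h1.pow 2).mul (ha.pow 2))
    simpa [hn.zero] using this

end Coefficients

/-! ### Uniform limits of the metric functions at spatial infinity. -/

theorem IsBigOInv.tendsto {n : ℕ} (hn : n ≠ 0) {f : ℝ → ℝ → ℝ} (hf : IsBigOInv n f) :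
    Tendsto (fun p : ℝ × ℝ => f p.1 p.2) (atTop ×ˢ (⊤ : Filter ℝ)) (𝓝 0) :=
  hf.trans_tendsto ((tendsto_pow_atTop hn).inv_tendsto_atTop.comp tendsto_fst)

theorem tendsto_div_fst (M : ℝ) :
    Tendsto (fun p : ℝ × ℝ => M / p.1) (atTop ×ˢ (⊤ : Filter ℝ)) (𝓝 0) :=
  (tendsto_const_nhds.div_atTop tendsto_id).comp tendsto_fst

section Infinity

variable {h : MetricFunctions} {M J : ℝ}

theorem MetricFunctions.IsAMC.tendsto_N (ha : h.IsAMC M J) :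
    Tendsto (fun p : ℝ × ℝ => h.N p.1 p.2) (atTop ×ˢ (⊤ : Filter ℝ)) (𝓝 1) := by
  have := (ha.expandN.tendsto two_ne_zero).add ((tendsto_div_fst M).const_sub 1)
  simpa only [sub_add_cancel, sub_zero, zero_add] using this

theorem MetricFunctions.IsAMC.tendsto_A (ha : h.IsAMC M J) :
    Tendsto (fun p : ℝ × ℝ => h.A p.1 p.2) (atTop ×ˢ (⊤ : Filter ℝ)) (𝓝 1) := by
  have := (ha.expandA.tendsto two_ne_zero).add ((tendsto_div_fst M).const_add 1)
  simpa only [sub_add_cancel, add_zero, zero_add] using this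

theorem MetricFunctions.IsAMC.tendsto_B (ha : h.IsAMC M J) :
    Tendsto (fun p : ℝ × ℝ => h.B p.1 p.2) (atTop ×ˢ (⊤ : Filter ℝ)) (𝓝 1) := by
  simpa using (ha.expandB.tendsto two_ne_zero).add_const 1

end Infinity

theorem eventually_prod_top {l : Filter ℝ} {P : ℝ × ℝ → Prop} :
    (∀ᶠ p in l ×ˢ (⊤ : Filter ℝ), P p) ↔ ∀ᶠ r in l, ∀ θ, P (r, θ) := by
  rw [eventually_prod_iff]
  constructor
  · rintro ⟨pa, ha, pb, hb, hP⟩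
    filter_upwards [ha] with r hr θ using hP hr (eventually_top.1 hb θ)
  · intro hP
    exact ⟨_, hP, fun _ => True, by simp, fun hr _ _ => hr _⟩

/-! ### The energy identity and uniqueness -/

/-- The radial flux of `χ ∇χ` through the sphere of radius `r`. -/
def MetricFunctions.energyFlux (h : MetricFunctions) (χ : ℝ → ℝ → ℝ) (r : ℝ) : ℝ :=
  ∫ θ in (0 : ℝ)..Real.pi,
    h.radialCoeff r θ * deriv (fun s => χ s θ) r * Real.sin θ * χ r θ

/-- The density of the Dirichlet energy of `χ`. -/
def MetricFunctions.energyDensity (h : MetricFunctions) (χ : ℝ → ℝ → ℝ) (r θ : ℝ) : ℝ :=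
  (h.radialCoeff r θ * deriv (fun s => χ s θ) r ^ 2 +
    h.angularCoeff r θ * deriv (fun s => χ r s) θ ^ 2) * Real.sin θ

section Energy

variable {h : MetricFunctions} {rH : ℝ} {χ : ℝ → ℝ → ℝ}

theorem MetricFunctions.IsSpacetime.contDiffOn_radialFlux (hs : h.IsSpacetime rH)
    (hχ : IsRegularOutside rH χ) :
    ContDiffOn ℝ 1 (fun p : ℝ × ℝ => h.radialCoeff p.1 p.2 * deriv (fun s => χ s p.2) p.1)
      (Ioi rH ×ˢ univ) :=
  (hs.contDiffOn_radialCoeff.of_le (by norm_num)).mul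
    (contDiffOn_deriv_fst (isOpen_outside rH) (by norm_num) hχ.contDiffOn)

theorem MetricFunctions.IsSpacetime.contDiffOn_angularFlux (hs : h.IsSpacetime rH)
    (hχ : IsRegularOutside rH χ) :
    ContDiffOn ℝ 1 (fun p : ℝ × ℝ => h.angularCoeff p.1 p.2 * Real.sin p.2 *
      deriv (fun s => χ p.1 s) p.2) (Ioi rH ×ˢ univ) :=
  ((hs.contDiffOn_angularCoeff.of_le (by norm_num)).mul
    (Real.contDiff_sin.comp contDiff_snd).contDiffOn).mul
    (contDiffOn_deriv_snd (isOpen_outside rH) (by norm_num) hχ.contDiffOn)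

theorem continuous_section {U : Set (ℝ × ℝ)} {F : ℝ × ℝ → ℝ} (hF : ContinuousOn F U) {r : ℝ}
    (hr : ∀ θ, (r, θ) ∈ U) : Continuous fun θ => F (r, θ) :=
  continuousOn_univ.1 (hF.comp (f := fun θ : ℝ => (r, θ)) (by fun_prop) fun θ _ => hr θ)

theorem MetricFunctions.IsSpacetime.continuous_energyDensity (hs : h.IsSpacetime rH)
    (hχ : IsRegularOutside rH χ) {r : ℝ} (hr : rH < r) :
    Continuous (h.energyDensity χ r) := by
  have hU := isOpen_outside rH
  have hm : ∀ θ : ℝ, (r, θ) ∈ Ioi rH ×ˢ (univ : Set ℝ) := fun θ => ⟨hr, trivial⟩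
  have h1 := continuous_section hs.contDiffOn_radialCoeff.continuousOn hm
  have h2 := continuous_section hs.contDiffOn_angularCoeff.continuousOn hm
  have h3 := continuous_section
    (contDiffOn_deriv_fst (m := 1) hU (by norm_num) hχ.contDiffOn).continuousOn hm
  have h4 := continuous_section
    (contDiffOn_deriv_snd (m := 1) hU (by norm_num) hχ.contDiffOn).continuousOn hm
  simp only at h1 h2 h3 h4
  unfold MetricFunctions.energyDensity
  fun_prop

theorem MetricFunctions.IsSpacetime.energyDensity_nonneg (h0 : 0 ≤ rH) (hs : h.IsSpacetime rH)
    {r θ : ℝ} (hr : rH < r) (hθ : θ ∈ Icc 0 Real.pi) : 0 ≤ h.energyDensity χ r θ := by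
  have := hs.radialCoeff_pos h0 hr θ
  have := hs.angularCoeff_pos hr θ
  have := Real.sin_nonneg_of_mem_Icc hθ
  unfold MetricFunctions.energyDensity
  positivity

/-- Multiply the equation by `χ` and integrate over the sphere. The angular divergence, integrated
by parts, turns into the angular part of the energy; its boundary terms vanish with `sin θ` on the
axis. -/
theorem MetricFunctions.IsSpacetime.hasDerivAt_energyFlux (hs : h.IsSpacetime rH)
    (hχ : IsRegularOutside rH χ)
    (heq : ∀ r > rH, ∀ θ ∈ Ioo 0 Real.pi, h.waveOp χ r θ = 0) {r : ℝ} (hr : rH < r) :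
    HasDerivAt (h.energyFlux χ) (∫ θ in (0 : ℝ)..Real.pi, h.energyDensity χ r θ) r := by
  have hU := isOpen_outside rH
  have hm : ∀ θ : ℝ, (r, θ) ∈ Ioi rH ×ˢ (univ : Set ℝ) := fun θ => ⟨hr, trivial⟩
  have hrad := hs.contDiffOn_radialFlux hχ
  have hang := hs.contDiffOn_angularFlux hχ
  have hχ1 := hχ.contDiffOn.of_le (m := 1) (by norm_num)
  set K : ℝ × ℝ → ℝ := fun q => h.radialCoeff q.2 q.1 * deriv (fun s => χ s q.1) q.2 *
    Real.sin q.1 * χ q.2 q.1 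
  have hK : ContDiffOn ℝ 1 K (univ ×ˢ Ioi rH) := by
    have hsw : ContDiffOn ℝ 1 (fun q : ℝ × ℝ => (q.2, q.1)) (univ ×ˢ Ioi rH) := by fun_prop
    have hmaps : MapsTo (fun q : ℝ × ℝ => (q.2, q.1)) (univ ×ˢ Ioi rH) (Ioi rH ×ˢ univ) :=
      fun q hq => ⟨hq.2, trivial⟩
    exact ((hrad.comp hsw hmaps).mul (Real.contDiff_sin.comp contDiff_fst).contDiffOn).mul
      (hχ1.comp hsw hmaps)
  have hVo : IsOpen ((univ : Set ℝ) ×ˢ Ioi rH) := isOpen_univ.prod isOpen_Ioi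
  have hV : uIcc 0 Real.pi ×ˢ Ioi rH ⊆ (univ : Set ℝ) ×ˢ Ioi rH :=
    prod_mono (subset_univ _) subset_rfl
  have hE := (hasFDerivAt_parametric_integral hK isOpen_Ioi hVo hV hr).hasDerivAt
  have hKc : ContinuousOn (fun q => (fderiv ℝ K q).comp (ContinuousLinearMap.inr ℝ ℝ ℝ))
      (univ ×ˢ Ioi rH) :=
    (hK.continuousOn_fderiv_of_isOpen hVo le_rfl).clm_comp continuousOn_const
  have hKi := (continuousOn_slice hKc hV hr).intervalIntegrable (μ := MeasureTheory.volume)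
  rw [ContinuousLinearMap.intervalIntegral_apply hKi] at hE
  refine hE.congr_deriv ?_
  -- the angular flux integrates to zero
  set Q : ℝ → ℝ := fun θ => h.angularCoeff r θ * Real.sin θ * deriv (fun s => χ r s) θ * χ r θ
  have hQd : ∀ θ, HasDerivAt Q (deriv (fun τ => h.angularCoeff r τ * Real.sin τ *
      deriv (fun τ' => χ r τ') τ) θ * χ r θ + h.angularCoeff r θ * Real.sin θ *
      deriv (fun s => χ r s) θ * deriv (fun s => χ r s) θ) θ := fun θ =>
    (hasDerivAt_deriv_snd (f := fun r τ => h.angularCoeff r τ * Real.sin τ *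
      deriv (fun s => χ r s) τ) hU one_ne_zero hang (hm θ)).mul
      (hasDerivAt_deriv_snd hU one_ne_zero hχ1 (hm θ))
  have hQc : Continuous fun θ => deriv (fun τ => h.angularCoeff r τ * Real.sin τ *
      deriv (fun τ' => χ r τ') τ) θ * χ r θ + h.angularCoeff r θ * Real.sin θ *
      deriv (fun s => χ r s) θ * deriv (fun s => χ r s) θ := by
    have h1 := continuous_section (contDiffOn_deriv_snd (f := fun r τ => h.angularCoeff r τ *
      Real.sin τ * deriv (fun s => χ r s) τ) (m := 0) hU (by norm_num) hang).continuousOn hm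
    have h2 := continuous_section hang.continuousOn hm
    have h3 := hχ.continuous hr
    have h4 := continuous_section (contDiffOn_deriv_snd (m := 0) hU (n := 1) (by norm_num)
      hχ1).continuousOn hm
    exact (h1.mul h3).add (h2.mul h4)
  have hQ := intervalIntegral.integral_eq_sub_of_hasDerivAt (a := 0) (b := Real.pi)
    (fun θ _ => hQd θ) (hQc.intervalIntegrable _ _)
  have hQ0 : Q Real.pi - Q 0 = 0 := by simp [Q]
  rw [hQ0] at hQ
  have hKi' : IntervalIntegrable (fun θ => (fderiv ℝ K (θ, r)).comp
      (ContinuousLinearMap.inr ℝ ℝ ℝ) 1) MeasureTheory.volume 0 Real.pi :=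
    ((continuousOn_slice hKc hV hr).clm_apply continuousOn_const).intervalIntegrable
  refine (add_zero _).symm.trans ?_
  refine (congrArg _ hQ.symm).trans ?_
  rw [← intervalIntegral.integral_add hKi' (hQc.intervalIntegrable _ _)]
  refine intervalIntegral.integral_congr_ae ?_
  -- The equation is assumed only for `0 < θ < π`, so the endpoint `π` is discarded as a null set.
  have hne : ∀ᵐ θ : ℝ, θ ≠ Real.pi := MeasureTheory.Measure.ae_ne _ _
  filter_upwards [hne] with θ hθπ hθ
  rw [uIoc_of_le Real.pi_pos.le] at hθ
  have hθ' : θ ∈ Ioo 0 Real.pi := ⟨hθ.1, lt_of_le_of_ne hθ.2 hθπ⟩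
  have hw := heq r hr θ hθ'
  have hKd : HasDerivAt (fun s => K (θ, s))
      ((fderiv ℝ K (θ, r)).comp (ContinuousLinearMap.inr ℝ ℝ ℝ) 1) r := by
    have h1 : HasFDerivAt K (fderiv ℝ K (θ, r)) (θ, r) :=
      ((hK.differentiableOn one_ne_zero).differentiableAt
        (hVo.mem_nhds (mk_mem_prod trivial hr))).hasFDerivAt
    exact (h1.comp r (hasFDerivAt_prodMk_right θ r)).hasDerivAt
  have hKd' : HasDerivAt (fun s => K (θ, s)) (deriv (fun s => h.radialCoeff s θ *
      deriv (fun s' => χ s' θ) s) r * Real.sin θ * χ r θ + h.radialCoeff r θ *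
      deriv (fun s => χ s θ) r * Real.sin θ * deriv (fun s => χ s θ) r) r :=
    ((hasDerivAt_deriv_fst (f := fun r θ => h.radialCoeff r θ * deriv (fun s => χ s θ) r)
      hU one_ne_zero hrad (hm θ)).mul_const (Real.sin θ)).mul
      (hasDerivAt_deriv_fst hU one_ne_zero hχ1 (hm θ))
  rw [hKd.unique hKd']
  unfold MetricFunctions.waveOp at hw
  unfold MetricFunctions.energyDensity
  linear_combination χ r θ * hw

theorem abs_energyFlux_le {r c : ℝ} (hc : ∀ θ ∈ Icc 0 Real.pi,
    |h.radialCoeff r θ * deriv (fun s => χ s θ) r * χ r θ| ≤ c) :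
    |h.energyFlux χ r| ≤ c * Real.pi := by
  have := intervalIntegral.norm_integral_le_of_norm_le_const (a := 0) (b := Real.pi) (C := c)
    (f := fun θ => h.radialCoeff r θ * deriv (fun s => χ s θ) r * Real.sin θ * χ r θ) ?_
  · simpa [MetricFunctions.energyFlux, abs_of_pos Real.pi_pos] using this
  · intro θ hθ
    rw [uIoc_of_le Real.pi_pos.le] at hθ
    rw [Real.norm_eq_abs, show h.radialCoeff r θ * deriv (fun s => χ s θ) r * Real.sin θ * χ r θ =
      h.radialCoeff r θ * deriv (fun s => χ s θ) r * χ r θ * Real.sin θ by ring, abs_mul]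
    exact (mul_le_of_le_one_right (abs_nonneg _) (Real.abs_sin_le_one θ)).trans
      (hc θ ⟨hθ.1.le, hθ.2⟩)

/-- The integrand factors as `(N r²B²) · (∂_r χ / A) · χ · sin θ`: the first factor tends to zero
uniformly and the others are bounded. -/
theorem tendsto_energyFlux_inner (hinner : h.IsBlackHole rH ∨ h.IsNeutronStar rH) {C : ℝ}
    (hin : ∀ᶠ r in 𝓝[>] rH, ∀ θ, |χ r θ| ≤ C ∧ |deriv (fun s => χ s θ) r / h.A r θ| ≤ C) :
    Tendsto (h.energyFlux χ) (𝓝[>] rH) (𝓝 0) := by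
  rw [Metric.tendsto_nhds]
  intro ε hε
  -- The `+ 1` keeps the denominator positive when `C = 0` and makes the final estimate, with factor
  -- `C² / (C² + 1)`, strictly less than `ε`.
  have hflux := eventually_prod_top.1 ((Metric.tendsto_nhds.1
    (MetricFunctions.tendsto_inner_flux hinner)) (ε / ((C ^ 2 + 1) * Real.pi))
      (by have := Real.pi_pos; positivity))
  filter_upwards [hin, hflux] with r h1 h2
  rw [Real.dist_0_eq_abs]
  have hC : 0 ≤ C := (abs_nonneg _).trans (h1 0).1
  have hb : |h.energyFlux χ r| ≤ (ε / ((C ^ 2 + 1) * Real.pi) * C ^ 2) * Real.pi := by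
    refine abs_energyFlux_le fun θ _ => ?_
    have h3 := h2 θ
    rw [Real.dist_0_eq_abs] at h3
    obtain ⟨h4, h5⟩ := h1 θ
    calc |h.radialCoeff r θ * deriv (fun s => χ s θ) r * χ r θ| =
        |h.N r θ * (r ^ 2 * h.B r θ ^ 2)| * (|deriv (fun s => χ s θ) r / h.A r θ| * |χ r θ|) := by
          rw [← abs_mul, ← abs_mul]
          congr 1
          unfold MetricFunctions.radialCoeff
          ring
      _ ≤ ε / ((C ^ 2 + 1) * Real.pi) * (C * C) := by gcongr
      _ = _ := by ring
  refine hb.trans_lt ?_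
  have hp := Real.pi_pos
  rw [show ε / ((C ^ 2 + 1) * Real.pi) * C ^ 2 * Real.pi = ε * (C ^ 2 / (C ^ 2 + 1)) by
    field_simp]
  exact mul_lt_of_lt_one_right hε (by rw [div_lt_one (by positivity)]; linarith)

/-- The radial coefficient grows like `r²`, against `r⁻²` from `∂_r χ` and `r⁻¹` from `χ`; the flux
is `O(1/r)`. -/
theorem tendsto_energyFlux_atTop {M J : ℝ} (hAMC : h.IsAMC M J) {C : ℝ}
    (hout : ∀ᶠ r in atTop, ∀ θ ∈ Icc 0 Real.pi,
      |χ r θ| ≤ C * r⁻¹ ∧ |deriv (fun s => χ s θ) r| ≤ C * (r ^ 2)⁻¹) :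
    Tendsto (h.energyFlux χ) atTop (𝓝 0) := by
  have hk : Tendsto (fun p : ℝ × ℝ => h.N p.1 p.2 * h.B p.1 p.2 ^ 2 / h.A p.1 p.2)
      (atTop ×ˢ (⊤ : Filter ℝ)) (𝓝 1) := by
    have := (hAMC.tendsto_N.mul (hAMC.tendsto_B.pow 2)).div hAMC.tendsto_A one_ne_zero
    rwa [one_pow, mul_one, div_one] at this
  have hk2 := eventually_prod_top.1 (hk.abs.eventually_lt_const (u := 2) (by norm_num))
  have hlim : Tendsto (fun r : ℝ => 2 * (C * C) * Real.pi * r⁻¹) atTop (𝓝 0) := by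
    simpa using tendsto_inv_atTop_zero.const_mul (2 * (C * C) * Real.pi)
  refine squeeze_zero_norm' ?_ hlim
  filter_upwards [hout, hk2, eventually_gt_atTop 0] with r h1 h2 hr
  have hb : |h.energyFlux χ r| ≤ (2 * (C * C) * r⁻¹) * Real.pi := by
    refine abs_energyFlux_le fun θ hθ => ?_
    obtain ⟨h4, h5⟩ := h1 θ hθ
    calc |h.radialCoeff r θ * deriv (fun s => χ s θ) r * χ r θ| =
        |h.N r θ * h.B r θ ^ 2 / h.A r θ| * r ^ 2 *
          (|deriv (fun s => χ s θ) r| * |χ r θ|) := by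
          rw [← abs_mul, ← abs_sq r, ← abs_mul, ← abs_mul]
          congr 1
          unfold MetricFunctions.radialCoeff
          ring
      _ ≤ 2 * r ^ 2 * ((C * (r ^ 2)⁻¹) * (C * r⁻¹)) := by
          have := (abs_nonneg _).trans h5
          gcongr
          exact (h2 θ).le
      _ = _ := by field_simp
  rw [Real.norm_eq_abs]
  exact hb.trans_eq (by ring)

/-- A regular static solution of the wave equation that decays at infinity vanishes. -/
theorem MetricFunctions.eq_zero_of_waveOp_eq_zero {M J : ℝ} (hs : h.IsSpacetime rH)
    (hAMC : h.IsAMC M J) (hinner : h.IsBlackHole rH ∨ h.IsNeutronStar rH)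
    (hχ : IsRegularOutside rH χ)
    (heq : ∀ r > rH, ∀ θ ∈ Ioo 0 Real.pi, h.waveOp χ r θ = 0) {C C' : ℝ}
    (hin : ∀ᶠ r in 𝓝[>] rH, ∀ θ, |χ r θ| ≤ C ∧ |deriv (fun s => χ s θ) r / h.A r θ| ≤ C)
    (hout : ∀ᶠ r in atTop, ∀ θ ∈ Icc 0 Real.pi,
      |χ r θ| ≤ C' * r⁻¹ ∧ |deriv (fun s => χ s θ) r| ≤ C' * (r ^ 2)⁻¹) :
    ∀ r > rH, ∀ θ, χ r θ = 0 := by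
  have h0 := MetricFunctions.inner_nonneg hinner
  have hder := fun r (hr : rH < r) => hs.hasDerivAt_energyFlux hχ heq hr
  have hnn : ∀ r, rH < r → 0 ≤ ∫ θ in (0 : ℝ)..Real.pi, h.energyDensity χ r θ := fun r hr =>
    intervalIntegral.integral_nonneg Real.pi_pos.le fun θ hθ => hs.energyDensity_nonneg h0 hr hθ
  have hmono : MonotoneOn (h.energyFlux χ) (Ioi rH) := by
    refine monotoneOn_of_deriv_nonneg (convex_Ioi rH)
      (fun r hr => (hder r hr).continuousAt.continuousWithinAt) ?_ ?_ <;> rw [interior_Ioi]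
    · exact fun r hr => (hder r hr).differentiableAt.differentiableWithinAt
    · intro r hr
      rw [(hder r hr).deriv]
      exact hnn r hr
  -- A monotone function with limit zero at both ends vanishes.
  have hzero : ∀ r, rH < r → h.energyFlux χ r = 0 := by
    intro r hr
    apply le_antisymm
    · refine ge_of_tendsto (tendsto_energyFlux_atTop hAMC hout) ?_
      filter_upwards [eventually_ge_atTop r] with s hs using hmono hr (hr.trans_le hs) hs
    · refine le_of_tendsto (tendsto_energyFlux_inner hinner hin) ?_
      filter_upwards [Ioo_mem_nhdsGT hr] with s hs using hmono hs.1 hr hs.2.le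
  have hint : ∀ r, rH < r → ∫ θ in (0 : ℝ)..Real.pi, h.energyDensity χ r θ = 0 := by
    intro r hr
    refine (hder r hr).unique ((hasDerivAt_const r (0 : ℝ)).congr_of_eventuallyEq ?_)
    filter_upwards [lt_mem_nhds hr] with s hs using hzero s hs
  -- A continuous nonnegative density with zero integral vanishes pointwise. Its radial part
  -- suffices, since `χ` is then constant along each ray and decays.
  have hderiv0 : ∀ r, rH < r → ∀ θ ∈ Ioo 0 Real.pi, deriv (fun s => χ s θ) r = 0 := by
    intro r hr θ hθ
    have hD : h.energyDensity χ r θ = 0 := by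
      by_contra hne
      have hpos : 0 < h.energyDensity χ r θ :=
        lt_of_le_of_ne (hs.energyDensity_nonneg h0 hr ⟨hθ.1.le, hθ.2.le⟩) (Ne.symm hne)
      exact (intervalIntegral.integral_pos Real.pi_pos
        (hs.continuous_energyDensity hχ hr).continuousOn
        (fun x hx => hs.energyDensity_nonneg h0 hr ⟨hx.1.le, hx.2⟩)
        ⟨θ, ⟨hθ.1.le, hθ.2.le⟩, hpos⟩).ne' (hint r hr)
    unfold MetricFunctions.energyDensity at hD
    have h1 := hs.radialCoeff_pos h0 hr θ
    have h2 := hs.angularCoeff_pos hr θ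
    have h3 := (mul_eq_zero.1 hD).resolve_right (Real.sin_pos_of_mem_Ioo hθ).ne'
    have h4 : h.radialCoeff r θ * deriv (fun s => χ s θ) r ^ 2 = 0 := by
      have : 0 ≤ h.radialCoeff r θ * deriv (fun s => χ s θ) r ^ 2 := by positivity
      have : 0 ≤ h.angularCoeff r θ * deriv (fun s => χ r s) θ ^ 2 := by positivity
      linarith
    exact pow_eq_zero_iff two_ne_zero |>.1 ((mul_eq_zero.1 h4).resolve_left h1.ne')
  have hIoo : ∀ r, rH < r → ∀ θ ∈ Ioo 0 Real.pi, χ r θ = 0 := by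
    intro r hr θ hθ
    have hconst : ∀ s, rH < s → χ s θ = χ r θ := fun s hs' =>
      isOpen_Ioi.is_const_of_deriv_eq_zero isPreconnected_Ioi
        (fun x hx => ((hasDerivAt_deriv_fst (isOpen_outside rH) two_ne_zero hχ.contDiffOn
          (⟨hx, trivial⟩ : (x, θ) ∈ Ioi rH ×ˢ univ)).differentiableAt).differentiableWithinAt)
        (fun x hx => hderiv0 x hx θ hθ) hs' hr
    have hlim : Tendsto (fun s => χ s θ) atTop (𝓝 0) := by
      have hl : Tendsto (fun s : ℝ => C' * s⁻¹) atTop (𝓝 0) := by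
        simpa using tendsto_inv_atTop_zero.const_mul C'
      refine squeeze_zero_norm' ?_ hl
      filter_upwards [hout] with s hs' using (hs' θ ⟨hθ.1.le, hθ.2.le⟩).1
    refine tendsto_nhds_unique (tendsto_const_nhds.congr' ?_) hlim
    filter_upwards [eventually_gt_atTop rH] with s hs' using (hconst s hs').symm
  intro r hr
  exact eq_of_even_periodic (hχ.continuous hr) continuous_const (hχ.even r hr)
    (hχ.periodic r hr) (fun _ => rfl) (fun _ => rfl) (hIoo r hr)

end Energy

/-! ### Smooth expansions at infinity -/

theorem SmoothAtInfinity.exists_extension {f : ℝ → ℝ → ℝ} (hf : SmoothAtInfinity f) {c : ℝ → ℝ}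
    (hc : ∀ θ, Tendsto (fun r => f r θ) atTop (𝓝 (c θ))) :
    ∃ δ > 0, ∃ F : ℝ × ℝ → ℝ, ContDiffOn ℝ (⊤ : ℕ∞) F (strip δ) ∧ (∀ θ, F (0, θ) = c θ) ∧
      ∀ r > δ⁻¹, ∀ θ, f r θ = F (r⁻¹, θ) := by
  obtain ⟨δ, hδ, F, hF, hfF⟩ := hf
  refine ⟨δ, hδ, F, hF, fun θ => ?_, hfF⟩
  have hcont : ContinuousAt F (0, θ) :=
    hF.continuousOn.continuousAt ((isOpen_strip δ).mem_nhds ⟨by simpa using hδ, trivial⟩)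
  have h1 : Tendsto (fun r : ℝ => F (r⁻¹, θ)) atTop (𝓝 (F (0, θ))) :=
    hcont.tendsto.comp (tendsto_inv_atTop_zero.prodMk_nhds tendsto_const_nhds)
  refine tendsto_nhds_unique (h1.congr' ?_) (hc θ)
  filter_upwards [eventually_gt_atTop δ⁻¹] with r hr using (hfF r hr θ).symm

theorem inv_mem_strip {δ r : ℝ} (hδ : 0 < δ) (hr : δ⁻¹ < r) (θ : ℝ) : (r⁻¹, θ) ∈ strip δ := by
  have hr0 : 0 < r := (inv_pos.2 hδ).trans hr
  refine ⟨⟨?_, inv_lt_of_inv_lt₀ hδ hr⟩, trivial⟩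
  have := inv_pos.2 hr0
  linarith

/-- An expansion without constant term may be multiplied by `r`. -/
theorem SmoothAtInfinity.mul_radius {f : ℝ → ℝ → ℝ} (hf : SmoothAtInfinity f)
    (h0 : ∀ θ, Tendsto (fun r => f r θ) atTop (𝓝 0)) :
    SmoothAtInfinity fun r θ => r * f r θ := by
  obtain ⟨δ, hδ, F, hF, hF0, hfF⟩ := hf.exists_extension (c := fun _ => 0) h0
  obtain ⟨G, hG, hFG⟩ := exists_smooth_div hF hF0
  refine ⟨δ, hδ, G, hG, fun r hr θ => ?_⟩
  have hr0 : 0 < r := (inv_pos.2 hδ).trans hr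
  change r * f r θ = _
  rw [hfF r hr θ, hFG _ (inv_mem_strip hδ hr θ)]
  field_simp

/-! ### Leading terms of expansions in powers of `1/r` -/

/-- Near the direction `θ₀` and for large `r`, the field `f` equals `r ^ k` times a smooth function
of `(1/r, θ)` with value `f₀ θ` at `1/r = 0`. -/
def HasLead (θ₀ : ℝ) (k : ℤ) (f : (Fin 4 → ℝ) → ℝ) (f₀ : ℝ → ℝ) : Prop :=
  ∃ F : ℝ × ℝ → ℝ, ContDiffAt ℝ (⊤ : ℕ∞) F (0, θ₀) ∧ (∀ᶠ θ in 𝓝 θ₀, F (0, θ) = f₀ θ) ∧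
    ∀ᶠ p in atTop ×ˢ 𝓝 θ₀, ∀ t φ, f ![t, p.1, p.2, φ] = p.1 ^ k * F (p.1⁻¹, p.2)

theorem eventually_fst_pos (θ₀ : ℝ) : ∀ᶠ p : ℝ × ℝ in atTop ×ˢ 𝓝 θ₀, 0 < p.1 :=
  tendsto_fst.eventually (eventually_gt_atTop 0)

theorem tendsto_inv_fst (θ₀ : ℝ) :
    Tendsto (fun p : ℝ × ℝ => (p.1⁻¹, p.2)) (atTop ×ˢ 𝓝 θ₀) (𝓝 (0, θ₀)) :=
  (tendsto_inv_atTop_zero.comp tendsto_fst).prodMk_nhds tendsto_snd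

/-- This allows an asymptotic identity to be differentiated in `r` and in `θ`. -/
theorem eventually_nhds_of_prod {θ₀ : ℝ} {P : ℝ × ℝ → Prop}
    (h : ∀ᶠ p in atTop ×ˢ 𝓝 θ₀, P p) :
    ∀ᶠ p : ℝ × ℝ in atTop ×ˢ 𝓝 θ₀, (∀ᶠ s in 𝓝 p.1, P (s, p.2)) ∧ ∀ᶠ τ in 𝓝 p.2, P (p.1, τ) := by
  obtain ⟨pa, ha, pb, hb, hP⟩ := eventually_prod_iff.1 h
  obtain ⟨R, hR⟩ := eventually_atTop.1 ha
  refine eventually_prod_iff.2 ⟨_, eventually_gt_atTop R, _, eventually_eventually_nhds.2 hb, ?_⟩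
  intro r hr θ hθ
  refine ⟨?_, hθ.mono fun τ hτ => hP (hR r hr.le) hτ⟩
  filter_upwards [lt_mem_nhds hr] with s hs using hP (hR s hs.le) hθ.self_of_nhds

namespace HasLead

variable {θ₀ : ℝ} {k l : ℤ} {f g : (Fin 4 → ℝ) → ℝ} {f₀ g₀ : ℝ → ℝ}

theorem zero (θ₀ : ℝ) (k : ℤ) : HasLead θ₀ k (fun _ => 0) fun _ => 0 :=
  ⟨fun _ => 0, contDiffAt_const, by simp, by simp⟩

theorem congr_field (hf : HasLead θ₀ k f f₀)
    (hfg : ∀ᶠ p : ℝ × ℝ in atTop ×ˢ 𝓝 θ₀, ∀ t φ, f ![t, p.1, p.2, φ] = g ![t, p.1, p.2, φ]) :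
    HasLead θ₀ k g f₀ := by
  obtain ⟨F, hF, hF0, hfF⟩ := hf
  refine ⟨F, hF, hF0, ?_⟩
  filter_upwards [hfF, hfg] with p h1 h2 t φ
  rw [← h2, h1]

theorem congr_lead (hf : HasLead θ₀ k f f₀) (hfg : ∀ᶠ θ in 𝓝 θ₀, f₀ θ = g₀ θ) :
    HasLead θ₀ k f g₀ := by
  obtain ⟨F, hF, hF0, hfF⟩ := hf
  exact ⟨F, hF, hF0.mp (hfg.mono fun θ h1 h2 => h2.trans h1), hfF⟩

theorem congr (hf : HasLead θ₀ k f f₀) (hk : k = l) (hfg : ∀ x, f x = g x)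
    (hfg0 : ∀ θ, f₀ θ = g₀ θ) : HasLead θ₀ l g g₀ := by
  obtain rfl : f = g := funext hfg
  obtain rfl : f₀ = g₀ := funext hfg0
  exact hk ▸ hf

theorem add (hf : HasLead θ₀ k f f₀) (hg : HasLead θ₀ k g g₀) :
    HasLead θ₀ k (fun x => f x + g x) fun θ => f₀ θ + g₀ θ := by
  obtain ⟨F, hF, hF0, hfF⟩ := hf
  obtain ⟨G, hG, hG0, hgG⟩ := hg
  refine ⟨fun q => F q + G q, hF.add hG, ?_, ?_⟩
  · filter_upwards [hF0, hG0] with θ h1 h2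
    rw [h1, h2]
  · filter_upwards [hfF, hgG] with p h1 h2 t φ
    rw [h1, h2, mul_add]

theorem mul (hf : HasLead θ₀ k f f₀) (hg : HasLead θ₀ l g g₀) :
    HasLead θ₀ (k + l) (fun x => f x * g x) fun θ => f₀ θ * g₀ θ := by
  obtain ⟨F, hF, hF0, hfF⟩ := hf
  obtain ⟨G, hG, hG0, hgG⟩ := hg
  refine ⟨fun q => F q * G q, hF.mul hG, ?_, ?_⟩
  · filter_upwards [hF0, hG0] with θ h1 h2
    rw [h1, h2]
  · filter_upwards [hfF, hgG, eventually_fst_pos θ₀] with p h1 h2 hp t φ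
    rw [h1, h2, zpow_add₀ hp.ne']
    ring

theorem const_mul (c : ℝ) (hf : HasLead θ₀ k f f₀) :
    HasLead θ₀ k (fun x => c * f x) fun θ => c * f₀ θ := by
  obtain ⟨F, hF, hF0, hfF⟩ := hf
  refine ⟨fun q => c * F q, contDiffAt_const.mul hF, ?_, ?_⟩
  · filter_upwards [hF0] with θ h1
    rw [h1]
  · filter_upwards [hfF] with p h1 t φ
    rw [h1]
    ring

theorem neg (hf : HasLead θ₀ k f f₀) : HasLead θ₀ k (fun x => -f x) fun θ => -f₀ θ :=
  (hf.const_mul (-1)).congr rfl (by simp) (by simp)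

theorem sub (hf : HasLead θ₀ k f f₀) (hg : HasLead θ₀ k g g₀) :
    HasLead θ₀ k (fun x => f x - g x) fun θ => f₀ θ - g₀ θ :=
  (hf.add hg.neg).congr rfl (fun _ => (sub_eq_add_neg _ _).symm) fun _ => (sub_eq_add_neg _ _).symm

theorem sum {ι : Type} (s : Finset ι) {f : ι → (Fin 4 → ℝ) → ℝ} {f₀ : ι → ℝ → ℝ}
    (hf : ∀ i, HasLead θ₀ k (f i) (f₀ i)) :
    HasLead θ₀ k (fun x => ∑ i ∈ s, f i x) fun θ => ∑ i ∈ s, f₀ i θ := by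
  classical
  induction s using Finset.induction_on with
  | empty => simpa using zero θ₀ k
  | insert i s hi ih => simpa only [Finset.sum_insert hi] using (hf i).add ih

theorem inv (hf : HasLead θ₀ k f f₀) (h0 : f₀ θ₀ ≠ 0) :
    HasLead θ₀ (-k) (fun x => (f x)⁻¹) fun θ => (f₀ θ)⁻¹ := by
  obtain ⟨F, hF, hF0, hfF⟩ := hf
  refine ⟨fun q => (F q)⁻¹, hF.inv (by rwa [hF0.self_of_nhds]), ?_, ?_⟩
  · filter_upwards [hF0] with θ h1
    rw [h1]
  · filter_upwards [hfF] with p h1 t φ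
    rw [h1, mul_inv, zpow_neg]

theorem tendsto (hf : HasLead θ₀ k f f₀) (t φ : ℝ) :
    Tendsto (fun r => r ^ (-k) * f ![t, r, θ₀, φ]) atTop (𝓝 (f₀ θ₀)) := by
  obtain ⟨F, hF, hF0, hfF⟩ := hf
  have hθ : Tendsto (fun r : ℝ => (r, θ₀)) atTop (atTop ×ˢ 𝓝 θ₀) :=
    tendsto_id.prodMk tendsto_const_nhds
  rw [← hF0.self_of_nhds]
  refine (hF.continuousAt.tendsto.comp ((tendsto_inv_fst θ₀).comp hθ)).congr' ?_
  filter_upwards [hθ.eventually hfF, eventually_gt_atTop 0] with r h1 hr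
  rw [h1, ← mul_assoc, ← zpow_add₀ hr.ne', neg_add_cancel, zpow_zero, one_mul]
  rfl

theorem radius (θ₀ : ℝ) : HasLead θ₀ 1 (fun x => x 1) fun _ => 1 :=
  ⟨fun _ => 1, contDiffAt_const, by simp, by simp⟩

theorem sin (θ₀ : ℝ) : HasLead θ₀ 0 (fun x => Real.sin (x 2)) Real.sin :=
  ⟨fun q => Real.sin q.2, (Real.contDiff_sin.comp contDiff_snd).contDiffAt, by simp, by simp⟩

theorem of_smoothAtInfinity {f : ℝ → ℝ → ℝ} (hf : SmoothAtInfinity f) {c : ℝ → ℝ}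
    (hc : ∀ θ, Tendsto (fun r => f r θ) atTop (𝓝 (c θ))) (θ₀ : ℝ) :
    HasLead θ₀ 0 (fun x => f (x 1) (x 2)) c := by
  obtain ⟨δ, hδ, F, hF, hF0, hfF⟩ := hf.exists_extension hc
  refine ⟨F, hF.contDiffAt ((isOpen_strip δ).mem_nhds ⟨by simpa using hδ, trivial⟩),
    Eventually.of_forall hF0, ?_⟩
  filter_upwards [tendsto_fst.eventually (eventually_gt_atTop δ⁻¹)] with p hp t φ
  simpa using hfF _ hp _

end HasLead

/-- The power of `r` carried by a lower index `μ`. -/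
def weight : Fin 4 → ℤ := ![0, 0, 1, 1]

/-- The leading term of `∂_μ f` when `f` has leading term `r ^ k f₀`. -/
def leadDeriv (k : ℤ) (m : Fin 4) (f₀ : ℝ → ℝ) (θ : ℝ) : ℝ := ![0, k * f₀ θ, deriv f₀ θ, 0] m

theorem update_zero (t r θ φ s : ℝ) : Function.update ![t, r, θ, φ] 0 s = ![s, r, θ, φ] := by
  ext i; fin_cases i <;> simp

theorem update_one (t r θ φ s : ℝ) : Function.update ![t, r, θ, φ] 1 s = ![t, s, θ, φ] := by
  ext i; fin_cases i <;> simp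

theorem update_two (t r θ φ s : ℝ) : Function.update ![t, r, θ, φ] 2 s = ![t, r, s, φ] := by
  ext i; fin_cases i <;> simp

theorem update_three (t r θ φ s : ℝ) : Function.update ![t, r, θ, φ] 3 s = ![t, r, θ, s] := by
  ext i; fin_cases i <;> simp

/-- Smoothness of `F` up to `1/r = 0` is what makes termwise differentiation legitimate. `∂_r`
lowers the power by one and `∂_θ` keeps it, as `weight` prescribes; the `t` and `φ` derivatives
vanish, so any power would do for them. -/
theorem HasLead.pd {θ₀ : ℝ} {k : ℤ} {f : (Fin 4 → ℝ) → ℝ} {f₀ : ℝ → ℝ} (hf : HasLead θ₀ k f f₀)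
    (m : Fin 4) : HasLead θ₀ (k + weight m - 1) (pd m f) (leadDeriv k m f₀) := by
  obtain ⟨F, hF, hF0, hfF⟩ := hf
  have hFs : ∀ v : ℝ × ℝ, ContDiffAt ℝ (⊤ : ℕ∞) (fun q => fderiv ℝ F q v) (0, θ₀) := fun v =>
    (hF.fderiv_right (m := (⊤ : ℕ∞)) (by simp)).clm_apply contDiffAt_const
  have hFd : ∀ᶠ q in 𝓝 ((0 : ℝ), θ₀), HasFDerivAt F (fderiv ℝ F q) q := by
    filter_upwards [(hF.of_le (m := 1) (by simp)).eventually (by simp)] with q hq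
    exact (hq.differentiableAt one_ne_zero).hasFDerivAt
  have hFd' := (tendsto_inv_fst θ₀).eventually hFd
  fin_cases m
  · refine ⟨fun _ => 0, contDiffAt_const, by simp [leadDeriv], ?_⟩
    filter_upwards [hfF] with p hp t φ
    simp [SGB.pd, update_zero, hp]
  -- With `u = 1/r`, `∂_r (r^k F(u, θ)) = r^(k-1) (k F - u ∂_u F)`.
  · refine ⟨fun q => k * F q - q.1 * fderiv ℝ F q (1, 0),
      (contDiffAt_const.mul hF).sub (contDiffAt_fst.mul (hFs _)), ?_, ?_⟩
    · filter_upwards [hF0] with θ hθ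
      simp [leadDeriv, hθ]
    · filter_upwards [eventually_nhds_of_prod hfF, hFd', eventually_fst_pos θ₀] with p hp hd hr t φ
      have hd1 : HasDerivAt (fun s : ℝ => F (s⁻¹, p.2))
          (-(p.1 ^ 2)⁻¹ * fderiv ℝ F (p.1⁻¹, p.2) (1, 0)) p.1 := by
        have h2 := hd.comp_hasDerivAt p.1
          ((hasDerivAt_inv hr.ne').prodMk (hasDerivAt_const p.1 p.2))
        have h4 : fderiv ℝ F (p.1⁻¹, p.2) (-(p.1 ^ 2)⁻¹, 0) =
            -(p.1 ^ 2)⁻¹ * fderiv ℝ F (p.1⁻¹, p.2) (1, 0) := by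
          rw [← smul_eq_mul, ← map_smul]; simp
        exact h4 ▸ h2
      have hd2 := (hasDerivAt_zpow k p.1 (Or.inl hr.ne')).mul hd1
      have hev : (fun s => f ![t, s, p.2, φ]) =ᶠ[𝓝 p.1]
          ((fun s : ℝ => s ^ k) * fun s : ℝ => F (s⁻¹, p.2)) := by
        filter_upwards [hp.1] with s hs using hs t φ
      simp only [SGB.pd, Fin.mk_one, update_one]
      simp only [Matrix.cons_val_one, Matrix.cons_val_zero]
      rw [(hd2.congr_of_eventuallyEq hev).deriv]
      rw [show k + weight 1 - 1 = k - 1 by simp [weight], zpow_sub_one₀ hr.ne']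
      field_simp
      ring
  · refine ⟨fun q => fderiv ℝ F q (0, 1), hFs _, ?_, ?_⟩
    · have h0 : Tendsto (fun θ : ℝ => ((0 : ℝ), θ)) (𝓝 θ₀) (𝓝 (0, θ₀)) := by
        exact tendsto_const_nhds.prodMk_nhds tendsto_id
      filter_upwards [eventually_eventually_nhds.2 hF0, h0.eventually hFd] with θ hθ hd
      have h2 := hd.comp_hasDerivAt θ ((hasDerivAt_const θ (0 : ℝ)).prodMk (hasDerivAt_id θ))
      have hev : f₀ =ᶠ[𝓝 θ] (F ∘ fun τ => (0, τ)) := hθ.mono fun τ hτ => hτ.symm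
      simpa [leadDeriv] using (h2.congr_of_eventuallyEq hev).deriv.symm
    · filter_upwards [eventually_nhds_of_prod hfF, hFd'] with p hp hd t φ
      have h2 := (hd.comp_hasDerivAt p.2
        ((hasDerivAt_const p.2 p.1⁻¹).prodMk (hasDerivAt_id p.2))).const_mul (p.1 ^ k)
      have hev : (fun s => f ![t, p.1, s, φ]) =ᶠ[𝓝 p.2]
          fun s : ℝ => p.1 ^ k * F (p.1⁻¹, s) := by
        filter_upwards [hp.2] with s hs using hs t φ
      simp only [SGB.pd, Fin.reduceFinMk, update_two]
      simp only [Matrix.cons_val]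
      rw [(h2.congr_of_eventuallyEq hev).deriv]
      rw [show k + weight 2 - 1 = k by simp [weight]]
  · refine ⟨fun _ => 0, contDiffAt_const, by simp [leadDeriv], ?_⟩
    filter_upwards [hfF] with p hp t φ
    simp [SGB.pd, update_three, hp]

/-! ### Decay of the Gauss–Bonnet invariant -/

theorem tendsto_of_prod_top {f : ℝ → ℝ → ℝ} {c : ℝ}
    (hf : Tendsto (fun p : ℝ × ℝ => f p.1 p.2) (atTop ×ˢ (⊤ : Filter ℝ)) (𝓝 c)) (θ : ℝ) :
    Tendsto (fun r => f r θ) atTop (𝓝 c) :=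
  hf.comp (f := fun r => (r, θ)) (tendsto_id.prodMk tendsto_top)

theorem IsBigOInv.tendsto_pow_mul {n m : ℕ} (hmn : m < n) {f : ℝ → ℝ → ℝ} (hf : IsBigOInv n f)
    (θ : ℝ) : Tendsto (fun r => r ^ m * f r θ) atTop (𝓝 0) := by
  have h1 : (fun r => f r θ) =O[atTop] fun r : ℝ => (r ^ n)⁻¹ :=
    hf.comp_tendsto (k := fun r => (r, θ)) (tendsto_id.prodMk tendsto_top)
  refine ((isBigO_refl (fun r : ℝ => r ^ m) atTop).mul h1).trans_tendsto ?_
  refine ((tendsto_pow_atTop (Nat.sub_ne_zero_of_lt hmn)).inv_tendsto_atTop).congr' ?_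
  filter_upwards [eventually_gt_atTop 0] with r hr
  obtain ⟨d, rfl⟩ := Nat.exists_eq_add_of_lt hmn
  simp only [Pi.inv_apply, show m + d + 1 - m = d + 1 by omega]
  field_simp
  ring

/-- The diagonal components of the flat metric in spherical coordinates, without powers of `r`. -/
def flatMetric (a b : Fin 4) (θ : ℝ) : ℝ :=
  if a = b then ![-1, 1, 1, Real.sin θ ^ 2] a else 0

def flatMetricInv (a b : Fin 4) (θ : ℝ) : ℝ :=
  if a = b then ![-1, 1, 1, (Real.sin θ ^ 2)⁻¹] a else 0

/-- The Christoffel symbols of the flat metric in spherical coordinates, without powers of `r`. -/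
def flatChristoffel (l m n : Fin 4) (θ : ℝ) : ℝ :=
  (![fun _ _ => 0,
    ![![0, 0, 0, 0], ![0, 0, 0, 0], ![0, 0, -1, 0], ![0, 0, 0, -Real.sin θ ^ 2]],
    ![![0, 0, 0, 0], ![0, 0, 1, 0], ![0, 1, 0, 0], ![0, 0, 0, -(Real.sin θ * Real.cos θ)]],
    ![![0, 0, 0, 0], ![0, 0, 0, 1], ![0, 0, 0, Real.cos θ / Real.sin θ],
      ![0, 1, Real.cos θ / Real.sin θ, 0]]] : Fin 4 → Fin 4 → Fin 4 → ℝ) l m n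

/-- The derivatives in `θ` of the symbols `flatChristoffel`. -/
def flatChristoffelDeriv (l m n : Fin 4) (θ : ℝ) : ℝ :=
  (![fun _ _ => 0,
    ![![0, 0, 0, 0], ![0, 0, 0, 0], ![0, 0, 0, 0], ![0, 0, 0, -2 * Real.sin θ * Real.cos θ]],
    ![![0, 0, 0, 0], ![0, 0, 0, 0], ![0, 0, 0, 0],
      ![0, 0, 0, Real.sin θ ^ 2 - Real.cos θ ^ 2]],
    ![![0, 0, 0, 0], ![0, 0, 0, 0], ![0, 0, 0, -(Real.sin θ ^ 2)⁻¹],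
      ![0, 0, -(Real.sin θ ^ 2)⁻¹, 0]]] : Fin 4 → Fin 4 → Fin 4 → ℝ) l m n

theorem deriv_flatChristoffel {θ : ℝ} (hs : Real.sin θ ≠ 0) (l m n : Fin 4) :
    deriv (flatChristoffel l m n) θ = flatChristoffelDeriv l m n θ := by
  have hsin := Real.hasDerivAt_sin θ
  have hcos := Real.hasDerivAt_cos θ
  have h1 : HasDerivAt (fun θ => -Real.sin θ ^ 2) (-2 * Real.sin θ * Real.cos θ) θ := by
    exact (hsin.pow 2).neg.congr_deriv (by simp)
  have h2 : HasDerivAt (fun θ => -(Real.sin θ * Real.cos θ))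
      (Real.sin θ ^ 2 - Real.cos θ ^ 2) θ := by
    exact (hsin.mul hcos).neg.congr_deriv (by ring)
  have h3 : HasDerivAt (fun θ => Real.cos θ / Real.sin θ) (-(Real.sin θ ^ 2)⁻¹) θ := by
    refine (hcos.div hsin hs).congr_deriv ?_
    field_simp
    linarith [Real.sin_sq_add_cos_sq θ]
  have h0 : ∀ c : ℝ, HasDerivAt (fun _ : ℝ => c) 0 θ := fun c => hasDerivAt_const θ c
  fin_cases l <;> fin_cases m <;> fin_cases n <;>
    first | exact (h0 _).deriv | exact h1.deriv | exact h2.deriv | exact h3.deriv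

theorem deriv_flatMetric (a b : Fin 4) (θ : ℝ) : deriv (flatMetric a b) θ =
    if a = 3 ∧ b = 3 then 2 * Real.sin θ * Real.cos θ else 0 := by
  unfold flatMetric
  fin_cases a <;> fin_cases b <;> simp

/-- Flat space in spherical coordinates, with powers of `r` stripped off; `leadDeriv` restores what
`∂_r` does to them. The diagonal inverse collapses the sum to `s = l`. -/
theorem christoffel_lead {θ : ℝ} (hs : Real.sin θ ≠ 0) (l m n : Fin 4) :
    1 / 2 * ∑ s, flatMetricInv l s θ *
      (leadDeriv (weight s + weight n) m (flatMetric s n) θ +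
        leadDeriv (weight s + weight m) n (flatMetric s m) θ -
        leadDeriv (weight m + weight n) s (flatMetric m n) θ) = flatChristoffel l m n θ := by
  have hi : ∀ c : Fin 4 → ℝ, ∑ s, flatMetricInv l s θ * c s = flatMetricInv l l θ * c l :=
    fun c => Finset.sum_eq_single l (fun s _ hs => by simp [flatMetricInv, hs.symm]) (by simp)
  rw [hi fun s => _]
  fin_cases l <;> fin_cases m <;> fin_cases n <;>
    simp [flatMetricInv, leadDeriv, weight, deriv_flatMetric, flatChristoffel] <;>
    (try simp [flatMetric]) <;> (try field_simp)

-- Flatness of Minkowski space, checked component by component.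
set_option maxHeartbeats 2000000 in
theorem riemann_lead {θ : ℝ} (hs : Real.sin θ ≠ 0) (a b m n : Fin 4) :
    leadDeriv (weight n + weight b - weight a - 1) m (flatChristoffel a n b) θ -
      leadDeriv (weight m + weight b - weight a - 1) n (flatChristoffel a m b) θ +
      ∑ l, (flatChristoffel a m l θ * flatChristoffel l n b θ -
        flatChristoffel a n l θ * flatChristoffel l m b θ) = 0 := by
  have hsc := Real.sin_sq_add_cos_sq θ
  simp only [leadDeriv, deriv_flatChristoffel hs, Fin.sum_univ_four]
  fin_cases a <;> fin_cases b <;> fin_cases m <;> fin_cases n <;>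
    simp [weight, flatChristoffel, flatChristoffelDeriv] <;>
    (try field_simp) <;> linarith

section Decay

variable {g : MetricField} {θ₀ : ℝ}

theorem HasLead.christoffel
    (hg : ∀ a b, HasLead θ₀ (weight a + weight b) (fun x => g x a b) (flatMetric a b))
    (hgi : ∀ a b, HasLead θ₀ (-(weight a + weight b)) (fun x => (g x)⁻¹ a b) (flatMetricInv a b))
    (hθ : Real.sin θ₀ ≠ 0) (l m n : Fin 4) :
    HasLead θ₀ (weight m + weight n - weight l - 1) (christoffel g l m n)
      (flatChristoffel l m n) := by
  have hsin : ∀ᶠ θ in 𝓝 θ₀, Real.sin θ ≠ 0 := Real.continuous_sin.continuousAt.eventually_ne hθ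
  have h1 : ∀ s, HasLead θ₀ (weight m + weight n - weight l - 1) _ _ := fun s =>
    ((hgi l s).mul (((((hg s n).pd m).congr (l := weight s + weight n + weight m - 1) rfl
      (fun _ => rfl) fun _ => rfl).add (((hg s m).pd n).congr
      (l := weight s + weight n + weight m - 1) (by ring) (fun _ => rfl) fun _ => rfl)).sub
      (((hg m n).pd s).congr (l := weight s + weight n + weight m - 1) (by ring)
        (fun _ => rfl) fun _ => rfl))).congr (by ring) (fun _ => rfl) fun _ => rfl
  exact ((HasLead.sum Finset.univ h1).const_mul (1 / 2)).congr_lead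
    (hsin.mono fun θ hs => christoffel_lead hs l m n)

/-- By index weights alone the curvature would scale as `r⁻²` in an orthonormal frame; flatness
kills that coefficient. -/
theorem HasLead.riemann
    (hg : ∀ a b, HasLead θ₀ (weight a + weight b) (fun x => g x a b) (flatMetric a b))
    (hgi : ∀ a b, HasLead θ₀ (-(weight a + weight b)) (fun x => (g x)⁻¹ a b) (flatMetricInv a b))
    (hθ : Real.sin θ₀ ≠ 0) (a b m n : Fin 4) :
    HasLead θ₀ (weight b + weight m + weight n - weight a - 2) (riemann g a b m n)
      fun _ => 0 := by
  have hsin : ∀ᶠ θ in 𝓝 θ₀, Real.sin θ ≠ 0 := Real.continuous_sin.continuousAt.eventually_ne hθ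
  have hC := HasLead.christoffel hg hgi hθ
  have h1 : ∀ l, HasLead θ₀ (weight b + weight m + weight n - weight a - 2) _ _ := fun l =>
    (((hC a m l).mul (hC l n b)).congr (l := weight b + weight m + weight n - weight a - 2)
      (by ring) (fun _ => rfl) fun _ => rfl).sub
    (((hC a n l).mul (hC l m b)).congr (l := weight b + weight m + weight n - weight a - 2)
      (by ring) (fun _ => rfl) fun _ => rfl)
  exact (((((hC a n b).pd m).congr (l := weight b + weight m + weight n - weight a - 2)
      (by ring) (fun _ => rfl) fun _ => rfl).sub
    (((hC a m b).pd n).congr (l := weight b + weight m + weight n - weight a - 2)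
      (by ring) (fun _ => rfl) fun _ => rfl)).add (HasLead.sum Finset.univ h1)).congr_lead
    (hsin.mono fun θ hs => riemann_lead hs a b m n)

/-- In each quadratic contraction the index weights cancel, leaving `r⁻⁴` with zero coefficient.
Times the density, of order `r²`, this puts the source beyond order `r⁻²`. -/
theorem HasLead.gaussBonnet
    (hg : ∀ a b, HasLead θ₀ (weight a + weight b) (fun x => g x a b) (flatMetric a b))
    (hgi : ∀ a b, HasLead θ₀ (-(weight a + weight b)) (fun x => (g x)⁻¹ a b) (flatMetricInv a b))
    (hθ : Real.sin θ₀ ≠ 0) : HasLead θ₀ (-4) (gaussBonnet g) fun _ => 0 := by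
  have hR := HasLead.riemann hg hgi hθ
  have hRic : ∀ b n, HasLead θ₀ (weight b + weight n - 2) (ricci g b n) fun _ => 0 := fun b n =>
    (HasLead.sum Finset.univ fun a => (hR a b a n).congr (by ring) (fun _ => rfl)
      fun _ => rfl).congr rfl (fun _ => rfl) (by simp)
  have hS : HasLead θ₀ (-2) (ricciScalar g) fun _ => 0 :=
    (HasLead.sum Finset.univ fun b => HasLead.sum Finset.univ fun n =>
      ((hgi b n).mul (hRic b n)).congr (l := -2) (by ring) (fun _ => rfl)
        fun _ => rfl).congr rfl (fun _ => rfl) (by simp)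
  have hRic2 : HasLead θ₀ (-4) (ricciSq g) fun _ => 0 :=
    (HasLead.sum Finset.univ fun a => HasLead.sum Finset.univ fun b =>
      HasLead.sum Finset.univ fun c => HasLead.sum Finset.univ fun d =>
      ((((hgi a c).mul (hgi b d)).mul (hRic a b)).mul (hRic c d)).congr (l := -4) (by ring)
        (fun _ => rfl) fun _ => rfl).congr rfl (fun _ => rfl) (by simp)
  have hRiem2 : HasLead θ₀ (-4) (riemannSq g) fun _ => 0 :=
    (HasLead.sum Finset.univ fun a => HasLead.sum Finset.univ fun b =>
      HasLead.sum Finset.univ fun c => HasLead.sum Finset.univ fun d =>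
      HasLead.sum Finset.univ fun e => HasLead.sum Finset.univ fun f =>
      HasLead.sum Finset.univ fun p => HasLead.sum Finset.univ fun q =>
      ((((((hg a e).mul (hgi b f)).mul (hgi c p)).mul (hgi d q)).mul (hR a b c d)).mul
        (hR e f p q)).congr (l := -4) (by ring) (fun _ => rfl) fun _ => rfl).congr rfl
        (fun _ => rfl) (by simp)
  exact (((hS.mul hS).sub (hRic2.const_mul 4)).add hRiem2).congr rfl
    (fun x => by simp only [SGB.gaussBonnet]; ring) (by simp)

end Decay

/-! ### Leading terms of the asymptotically flat metric and its inverse. -/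

theorem MetricFunctions.hasLead_area {h : MetricFunctions} {θ₀ : ℝ}
    (hB : HasLead θ₀ 0 (fun x => h.B (x 1) (x 2)) fun _ => 1) :
    HasLead θ₀ 2 (fun x => x 1 ^ 2 * h.B (x 1) (x 2) ^ 2) fun _ => 1 :=
  (((HasLead.radius θ₀).mul (HasLead.radius θ₀)).mul (hB.mul hB)).congr (by norm_num)
    (fun x => by ring) (by simp)

theorem MetricFunctions.hasLead_axial {h : MetricFunctions} {θ₀ : ℝ}
    (hB : HasLead θ₀ 0 (fun x => h.B (x 1) (x 2)) fun _ => 1) :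
    HasLead θ₀ 2 (fun x => x 1 ^ 2 * h.B (x 1) (x 2) ^ 2 * Real.sin (x 2) ^ 2)
      fun θ => Real.sin θ ^ 2 :=
  ((hasLead_area hB).mul ((HasLead.sin θ₀).mul (HasLead.sin θ₀))).congr (by norm_num)
    (fun x => by ring) (fun θ => by ring)

theorem MetricFunctions.hasLead_metric {h : MetricFunctions} {θ₀ : ℝ}
    (hN : HasLead θ₀ 0 (fun x => h.N (x 1) (x 2)) fun _ => 1)
    (hA : HasLead θ₀ 0 (fun x => h.A (x 1) (x 2)) fun _ => 1)
    (hB : HasLead θ₀ 0 (fun x => h.B (x 1) (x 2)) fun _ => 1)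
    (hω : HasLead θ₀ (-1) (fun x => h.ω (x 1) (x 2)) fun _ => 0) (a b : Fin 4) :
    HasLead θ₀ (weight a + weight b) (fun x => h.metric x a b) (flatMetric a b) := by
  have hrB := hasLead_area hB
  have hP := hasLead_axial hB
  have hN2 : HasLead θ₀ 0 (fun x => h.N (x 1) (x 2) ^ 2) fun _ => 1 :=
    (hN.mul hN).congr (by norm_num) (fun x => by ring) (by simp)
  have hA2 : HasLead θ₀ 0 (fun x => h.A (x 1) (x 2) ^ 2) fun _ => 1 :=
    (hA.mul hA).congr (by norm_num) (fun x => by ring) (by simp)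
  have hg03 := (hP.neg.mul hω).congr (l := 1) (by norm_num) (fun _ => rfl) (g₀ := fun _ => 0)
    (by simp)
  fin_cases a <;> fin_cases b
  · exact (hN2.neg.add ((hP.mul (hω.mul hω)).congr (l := 0) (by norm_num) (fun _ => rfl)
      fun _ => rfl)).congr (by simp [weight]) (fun x => by
        change _ = -h.N (x 1) (x 2) ^ 2 + _ * h.ω (x 1) (x 2) ^ 2
        ring)
      (by simp [flatMetric])
  · exact HasLead.zero _ _
  · exact HasLead.zero _ _
  · exact hg03.congr (by simp [weight]) (fun x => by simp [MetricFunctions.metric])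
      (by simp [flatMetric])
  · exact HasLead.zero _ _
  · exact hA2
  · exact HasLead.zero _ _
  · exact HasLead.zero _ _
  · exact HasLead.zero _ _
  · exact HasLead.zero _ _
  · exact hrB
  · exact HasLead.zero _ _
  · exact hg03.congr (by simp [weight]) (fun x => by simp [MetricFunctions.metric])
      (by simp [flatMetric])
  · exact HasLead.zero _ _
  · exact HasLead.zero _ _
  · exact hP

theorem MetricFunctions.hasLead_metricInv {h : MetricFunctions} {θ₀ : ℝ}
    (hN : HasLead θ₀ 0 (fun x => h.N (x 1) (x 2)) fun _ => 1)
    (hA : HasLead θ₀ 0 (fun x => h.A (x 1) (x 2)) fun _ => 1)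
    (hB : HasLead θ₀ 0 (fun x => h.B (x 1) (x 2)) fun _ => 1)
    (hω : HasLead θ₀ (-1) (fun x => h.ω (x 1) (x 2)) fun _ => 0)
    (hsin : Real.sin θ₀ ≠ 0) (a b : Fin 4) :
    HasLead θ₀ (-(weight a + weight b)) (fun x => h.metricInv x a b) (flatMetricInv a b) := by
  have hrB := hasLead_area hB
  have hPi := (hasLead_axial hB).inv (pow_ne_zero 2 hsin)
  have hN2 : HasLead θ₀ 0 (fun x => h.N (x 1) (x 2) ^ 2) fun _ => 1 :=
    (hN.mul hN).congr (by norm_num) (fun x => by ring) (by simp)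
  have hA2 : HasLead θ₀ 0 (fun x => h.A (x 1) (x 2) ^ 2) fun _ => 1 :=
    (hA.mul hA).congr (by norm_num) (fun x => by ring) (by simp)
  have hN2i := hN2.inv one_ne_zero
  have hgi03 := (hω.mul hN2i).neg.congr (l := -1) (by norm_num) (fun _ => rfl) (g₀ := fun _ => 0)
    (by simp)
  fin_cases a <;> fin_cases b
  · exact hN2i.neg.congr (by simp [weight]) (fun x => by simp [MetricFunctions.metricInv])
      (by simp [flatMetricInv])
  · exact HasLead.zero _ _
  · exact HasLead.zero _ _
  · exact hgi03.congr (by simp [weight]) (fun x => by simp [MetricFunctions.metricInv])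
      (by simp [flatMetricInv])
  · exact HasLead.zero _ _
  · exact (hA2.inv one_ne_zero).congr (by simp [weight])
      (fun x => by simp [MetricFunctions.metricInv]) (by simp [flatMetricInv])
  · exact HasLead.zero _ _
  · exact HasLead.zero _ _
  · exact HasLead.zero _ _
  · exact HasLead.zero _ _
  · exact (hrB.inv one_ne_zero).congr (by simp [weight])
      (fun x => by simp [MetricFunctions.metricInv]) (by simp [flatMetricInv])
  · exact HasLead.zero _ _
  · exact hgi03.congr (by simp [weight]) (fun x => by simp [MetricFunctions.metricInv])
      (by simp [flatMetricInv])
  · exact HasLead.zero _ _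
  · exact HasLead.zero _ _
  · exact (hPi.add (((hω.mul hω).mul hN2i).neg.congr (l := -2) (by norm_num) (fun _ => rfl)
      fun _ => rfl)).congr (by simp [weight]) (fun x => by simp [MetricFunctions.metricInv])
      (by simp [flatMetricInv])

theorem MetricFunctions.IsAMC.hasLead_N {h : MetricFunctions} {M J : ℝ} (hAMC : h.IsAMC M J)
    (θ₀ : ℝ) : HasLead θ₀ 0 (fun x => h.N (x 1) (x 2)) fun _ => 1 :=
  HasLead.of_smoothAtInfinity hAMC.smoothN (tendsto_of_prod_top hAMC.tendsto_N) θ₀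

theorem MetricFunctions.IsAMC.hasLead_A {h : MetricFunctions} {M J : ℝ} (hAMC : h.IsAMC M J)
    (θ₀ : ℝ) : HasLead θ₀ 0 (fun x => h.A (x 1) (x 2)) fun _ => 1 :=
  HasLead.of_smoothAtInfinity hAMC.smoothA (tendsto_of_prod_top hAMC.tendsto_A) θ₀

theorem MetricFunctions.IsAMC.hasLead_B {h : MetricFunctions} {M J : ℝ} (hAMC : h.IsAMC M J)
    (θ₀ : ℝ) : HasLead θ₀ 0 (fun x => h.B (x 1) (x 2)) fun _ => 1 :=
  HasLead.of_smoothAtInfinity hAMC.smoothB (tendsto_of_prod_top hAMC.tendsto_B) θ₀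

/-- Weaker than the assumed `r⁻³` decay, but enough: `g_tφ` has weight one and carries `r² ω`, so
its flat leading coefficient is zero. -/
theorem MetricFunctions.IsAMC.hasLead_ω {h : MetricFunctions} {M J : ℝ} (hAMC : h.IsAMC M J)
    (θ₀ : ℝ) : HasLead θ₀ (-1) (fun x => h.ω (x 1) (x 2)) fun _ => 0 := by
  have hJ : ∀ k : ℕ, k < 3 → Tendsto (fun r : ℝ => r ^ k * (2 * J / r ^ 3)) atTop (𝓝 0) := by
    intro k hk
    have h1 := ((tendsto_pow_atTop (α := ℝ) (n := 3 - k) (by omega)).inv_tendsto_atTop).const_mul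
      (2 * J)
    rw [mul_zero] at h1
    refine h1.congr' ?_
    filter_upwards [eventually_gt_atTop 0] with r hr
    obtain ⟨d, hd⟩ : ∃ d, 3 = k + d := ⟨3 - k, by omega⟩
    rw [Pi.inv_apply, hd, Nat.add_sub_cancel_left, pow_add]
    field_simp
  have hz : ∀ k : ℕ, k < 3 → ∀ θ, Tendsto (fun r => r ^ k * h.ω r θ) atTop (𝓝 0) := by
    intro k hk θ
    have := (hAMC.expandω.tendsto_pow_mul (m := k) (by omega) θ).add (hJ k hk)
    rw [add_zero] at this
    exact this.congr fun r => by ring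
  have h1 := HasLead.of_smoothAtInfinity
    (hAMC.smoothω.mul_radius fun θ => by simpa using hz 0 (by norm_num) θ)
    (c := fun _ => 0) (fun θ => by simpa using hz 1 (by norm_num) θ) θ₀
  refine ((((HasLead.radius θ₀).inv one_ne_zero).mul h1).congr (by norm_num) (fun _ => rfl)
    (g₀ := fun _ => 0) (by simp)).congr_field ?_
  filter_upwards [eventually_fst_pos θ₀] with p hp t φ
  simp only [Matrix.cons_val_one, Matrix.cons_val_zero, Matrix.cons_val]
  field_simp

theorem MetricFunctions.IsAMC.hasLead_gaussBonnet {h : MetricFunctions} {rH M J : ℝ}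
    (hAMC : h.IsAMC M J) (h0 : 0 ≤ rH) (hs : h.IsSpacetime rH) {θ₀ : ℝ}
    (hθ : θ₀ ∈ Ioo 0 Real.pi) : HasLead θ₀ (-4) (gaussBonnet h.metric) fun _ => 0 := by
  have hsin : Real.sin θ₀ ≠ 0 := (Real.sin_pos_of_mem_Ioo hθ).ne'
  have hN := hAMC.hasLead_N θ₀
  have hA := hAMC.hasLead_A θ₀
  have hB := hAMC.hasLead_B θ₀
  have hω := hAMC.hasLead_ω θ₀
  have hgi : ∀ a b, HasLead θ₀ (-(weight a + weight b)) (fun x => (h.metric x)⁻¹ a b)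
      (flatMetricInv a b) := by
    intro a b
    refine (MetricFunctions.hasLead_metricInv hN hA hB hω hsin a b).congr_field ?_
    filter_upwards [tendsto_fst.eventually (eventually_gt_atTop rH),
      tendsto_snd.eventually (isOpen_Ioo.mem_nhds hθ)] with p hp hpθ t φ
    have hN0 := (hs.posN _ hp p.2).ne'
    have hA0 := (hs.posA _ hp p.2).ne'
    have hB0 := (hs.posB _ hp p.2).ne'
    have hr0 : p.1 ≠ 0 := (h0.trans_lt hp).ne'
    have hs0 : Real.sin p.2 ≠ 0 := (Real.sin_pos_of_mem_Ioo hpθ).ne'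
    have := h.metric_inv ![t, p.1, p.2, φ] hN0 hA0 hB0 hr0 hs0
    exact (congrFun (congrFun this a) b).symm
  have hg := MetricFunctions.hasLead_metric hN hA hB hω
  exact HasLead.gaussBonnet hg hgi hsin

/-! ### Algebra of the wave operator -/

section Algebra

variable {h : MetricFunctions} {rH : ℝ} {f g : ℝ → ℝ → ℝ}

theorem MetricFunctions.IsSpacetime.waveOp_add (hs : h.IsSpacetime rH)
    (hf : IsRegularOutside rH f) (hg : IsRegularOutside rH g) {r : ℝ} (hr : rH < r) (θ : ℝ) :
    h.waveOp (fun r θ => f r θ + g r θ) r θ = h.waveOp f r θ + h.waveOp g r θ := by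
  have hU := isOpen_outside rH
  have hm : ∀ r, rH < r → ∀ θ : ℝ, (r, θ) ∈ Ioi rH ×ˢ (univ : Set ℝ) :=
    fun r hr θ => ⟨hr, trivial⟩
  have e1 : (fun s => h.radialCoeff s θ * deriv (fun s' => f s' θ + g s' θ) s) =ᶠ[𝓝 r]
      fun s => h.radialCoeff s θ * deriv (fun s' => f s' θ) s +
        h.radialCoeff s θ * deriv (fun s' => g s' θ) s := by
    filter_upwards [lt_mem_nhds hr] with s hsr
    rw [← mul_add]
    congr 1
    exact ((hasDerivAt_deriv_fst hU two_ne_zero hf.contDiffOn (hm s hsr θ)).add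
      (hasDerivAt_deriv_fst hU two_ne_zero hg.contDiffOn (hm s hsr θ))).deriv
  have e2 : (fun τ => h.angularCoeff r τ * Real.sin τ * deriv (fun τ' => f r τ' + g r τ') τ) =
      fun τ => h.angularCoeff r τ * Real.sin τ * deriv (fun τ' => f r τ') τ +
        h.angularCoeff r τ * Real.sin τ * deriv (fun τ' => g r τ') τ := by
    funext τ
    rw [← mul_add]
    congr 1
    exact ((hasDerivAt_deriv_snd hU two_ne_zero hf.contDiffOn (hm r hr τ)).add
      (hasDerivAt_deriv_snd hU two_ne_zero hg.contDiffOn (hm r hr τ))).deriv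
  have d1 := (hasDerivAt_deriv_fst (f := fun r θ => h.radialCoeff r θ * deriv (fun s => f s θ) r)
    hU one_ne_zero (hs.contDiffOn_radialFlux hf) (hm r hr θ)).add
    (hasDerivAt_deriv_fst (f := fun r θ => h.radialCoeff r θ * deriv (fun s => g s θ) r)
    hU one_ne_zero (hs.contDiffOn_radialFlux hg) (hm r hr θ))
  have d2 := (hasDerivAt_deriv_snd (f := fun r θ => h.angularCoeff r θ * Real.sin θ *
    deriv (fun s => f r s) θ) hU one_ne_zero (hs.contDiffOn_angularFlux hf) (hm r hr θ)).add
    (hasDerivAt_deriv_snd (f := fun r θ => h.angularCoeff r θ * Real.sin θ *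
    deriv (fun s => g r s) θ) hU one_ne_zero (hs.contDiffOn_angularFlux hg) (hm r hr θ))
  unfold MetricFunctions.waveOp
  rw [e1.deriv_eq, e2]
  refine (congrArg₂ (fun a b => a * Real.sin θ + b) d1.deriv d2.deriv).trans ?_
  ring

theorem MetricFunctions.waveOp_neg (h : MetricFunctions) (f : ℝ → ℝ → ℝ) (r θ : ℝ) :
    h.waveOp (fun r θ => -f r θ) r θ = -h.waveOp f r θ := by
  simp [MetricFunctions.waveOp, deriv.fun_neg]
  ring

theorem deriv_comp_pi_sub (f : ℝ → ℝ) (θ : ℝ) :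
    deriv (fun τ => f (Real.pi - τ)) θ = -deriv f (Real.pi - θ) :=
  deriv_comp_const_sub (f := f) Real.pi θ

/-- The coefficients and `sin θ` are invariant, and the signs of the two `θ`-derivatives cancel. -/
theorem MetricFunctions.waveOp_comp_pi_sub
    (hsym : ∀ r > rH, ∀ θ, h.N r (Real.pi - θ) = h.N r θ ∧ h.A r (Real.pi - θ) = h.A r θ ∧
      h.B r (Real.pi - θ) = h.B r θ) {r : ℝ} (hr : rH < r) (θ : ℝ) :
    h.waveOp (fun r θ => f r (Real.pi - θ)) r θ = h.waveOp f r (Real.pi - θ) := by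
  have hrad : ∀ s, rH < s → h.radialCoeff s (Real.pi - θ) = h.radialCoeff s θ := fun s hs => by
    obtain ⟨h1, h2, h3⟩ := hsym s hs θ
    simp only [MetricFunctions.radialCoeff, h1, h2, h3]
  have hang : ∀ τ, h.angularCoeff r (Real.pi - τ) = h.angularCoeff r τ := fun τ => by
    obtain ⟨h1, h2, h3⟩ := hsym r hr τ
    simp only [MetricFunctions.angularCoeff, h1, h2]
  have e1 : (fun s => h.radialCoeff s θ * deriv (fun s' => f s' (Real.pi - θ)) s) =ᶠ[𝓝 r]
      fun s => h.radialCoeff s (Real.pi - θ) * deriv (fun s' => f s' (Real.pi - θ)) s := by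
    filter_upwards [lt_mem_nhds hr] with s hsr
    rw [hrad s hsr]
  have e2 : (fun τ => h.angularCoeff r τ * Real.sin τ * deriv (fun τ' => f r (Real.pi - τ')) τ) =
      fun τ => -((fun σ => h.angularCoeff r σ * Real.sin σ * deriv (fun τ' => f r τ') σ)
        (Real.pi - τ)) := by
    funext τ
    simp only
    rw [deriv_comp_pi_sub (f r) τ, hang, Real.sin_pi_sub]
    ring
  unfold MetricFunctions.waveOp
  rw [e1.deriv_eq, e2, deriv.fun_neg, deriv_comp_pi_sub (fun σ => h.angularCoeff r σ *
    Real.sin σ * deriv (fun τ' => f r τ') σ), neg_neg, Real.sin_pi_sub]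

/-- Symmetry passes from `(0, π)` to all angles by continuity, evenness and periodicity. `ω` is left
out because `waveOp` does not contain it. -/
theorem MetricFunctions.IsReflectionSymmetric.eq_pi_sub (h0 : 0 ≤ rH) (hs : h.IsSpacetime rH)
    (hrefl : h.IsReflectionSymmetric rH) (r : ℝ) (hr : rH < r) (θ : ℝ) :
    h.N r (Real.pi - θ) = h.N r θ ∧ h.A r (Real.pi - θ) = h.A r θ ∧
      h.B r (Real.pi - θ) = h.B r θ := by
  have key : ∀ f : ℝ → ℝ → ℝ, IsRegularOutside rH f →
      (∀ θ ∈ Ioo 0 Real.pi, f r (Real.pi - θ) = f r θ) → f r (Real.pi - θ) = f r θ :=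
    fun f hf hE => eq_of_even_periodic (hf.comp_pi_sub.continuous hr) (hf.continuous hr)
      (hf.comp_pi_sub.even r hr) (hf.comp_pi_sub.periodic r hr) (hf.even r hr)
      (hf.periodic r hr) hE θ
  have he := fun θ (hθ : θ ∈ Ioo 0 Real.pi) => hrefl.eq_of_mem_Ioo h0 hs hr hθ
  exact ⟨key _ hs.regN fun θ hθ => (he θ hθ).1, key _ hs.regA fun θ hθ => (he θ hθ).2.1,
    key _ hs.regB fun θ hθ => (he θ hθ).2.2.1⟩

/-- Boundedness at the inner end, in the form preserved by linear combinations. -/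
def MetricFunctions.InnerBounded (h : MetricFunctions) (rH : ℝ) (f : ℝ → ℝ → ℝ) : Prop :=
  ∃ C : ℝ, ∀ᶠ r in 𝓝[>] rH, ∀ θ, |f r θ| ≤ C ∧ |deriv (fun s => f s θ) r / h.A r θ| ≤ C

theorem MetricFunctions.IsRegularInside.innerBounded (hf : h.IsRegularInside rH f) :
    h.InnerBounded rH f := by
  obtain ⟨C₁, h1⟩ := hf.bounded.bound
  obtain ⟨C₂, h2⟩ := hf.gradient.bound
  -- The bound on the gradient is quadratic; `|a| ≤ a² + 1` makes it linear.
  refine ⟨max C₁ (C₂ + 1), ?_⟩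
  filter_upwards [eventually_prod_top.1 h1, eventually_prod_top.1 h2] with r h1 h2 θ
  have h1 := h1 θ
  have h2 := h2 θ
  simp only [norm_one, mul_one, Real.norm_eq_abs] at h1 h2
  refine ⟨h1.trans (le_max_left _ _), le_trans ?_ (le_max_right _ _)⟩
  have h3 := (le_abs_self _).trans h2
  set a := deriv (fun s => f s θ) r / h.A r θ
  set b := deriv (fun s => f r s) θ / (r * h.B r θ)
  have h4 : |a| ^ 2 = a ^ 2 := sq_abs a
  nlinarith [sq_nonneg (|a| - 1), sq_nonneg b, abs_nonneg a]

theorem MetricFunctions.InnerBounded.add (hf : h.InnerBounded rH f) (hg : h.InnerBounded rH g)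
    (hfr : IsRegularOutside rH f) (hgr : IsRegularOutside rH g) :
    h.InnerBounded rH fun r θ => f r θ + g r θ := by
  obtain ⟨C₁, h1⟩ := hf
  obtain ⟨C₂, h2⟩ := hg
  refine ⟨C₁ + C₂, ?_⟩
  filter_upwards [h1, h2, self_mem_nhdsWithin] with r h1 h2 hr θ
  have hd : deriv (fun s => f s θ + g s θ) r = _ :=
    ((hasDerivAt_deriv_fst (isOpen_outside rH) two_ne_zero hfr.contDiffOn
      (⟨hr, trivial⟩ : (r, θ) ∈ Ioi rH ×ˢ univ)).add
      (hasDerivAt_deriv_fst (isOpen_outside rH) two_ne_zero hgr.contDiffOn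
        (⟨hr, trivial⟩ : (r, θ) ∈ Ioi rH ×ˢ univ))).deriv
  rw [hd, add_div]
  exact ⟨(abs_add_le _ _).trans (add_le_add (h1 θ).1 (h2 θ).1),
    (abs_add_le _ _).trans (add_le_add (h1 θ).2 (h2 θ).2)⟩

theorem MetricFunctions.InnerBounded.neg (hf : h.InnerBounded rH f) :
    h.InnerBounded rH fun r θ => -f r θ := by
  obtain ⟨C, h1⟩ := hf
  refine ⟨C, ?_⟩
  filter_upwards [h1] with r h1 θ
  rw [deriv.fun_neg, neg_div, abs_neg, abs_neg]
  exact h1 θ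

theorem MetricFunctions.InnerBounded.comp_pi_sub (hf : h.InnerBounded rH f)
    (hsym : ∀ r > rH, ∀ θ, h.N r (Real.pi - θ) = h.N r θ ∧ h.A r (Real.pi - θ) = h.A r θ ∧
      h.B r (Real.pi - θ) = h.B r θ) :
    h.InnerBounded rH fun r θ => f r (Real.pi - θ) := by
  obtain ⟨C, h1⟩ := hf
  refine ⟨C, ?_⟩
  filter_upwards [h1, self_mem_nhdsWithin] with r h1 hr θ
  rw [← (hsym r hr θ).2.1]
  exact h1 (Real.pi - θ)

end Algebra

/-! ### Algebra of smooth expansions -/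

section Expansions

variable {f g : ℝ → ℝ → ℝ}

theorem SmoothAtInfinity.add (hf : SmoothAtInfinity f) (hg : SmoothAtInfinity g) :
    SmoothAtInfinity fun r θ => f r θ + g r θ := by
  obtain ⟨δ, hδ, F, hF, hfF⟩ := hf
  obtain ⟨η, hη, G, hG, hgG⟩ := hg
  have hm : 0 < min δ η := lt_min hδ hη
  have h1 : Ioo (-min δ η) (min δ η) ×ˢ (univ : Set ℝ) ⊆ Ioo (-δ) δ ×ˢ univ :=
    prod_mono (Ioo_subset_Ioo (neg_le_neg (min_le_left _ _)) (min_le_left _ _)) subset_rfl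
  have h2 : Ioo (-min δ η) (min δ η) ×ˢ (univ : Set ℝ) ⊆ Ioo (-η) η ×ˢ univ :=
    prod_mono (Ioo_subset_Ioo (neg_le_neg (min_le_right _ _)) (min_le_right _ _)) subset_rfl
  refine ⟨min δ η, hm, fun q => F q + G q, (hF.mono h1).add (hG.mono h2), fun r hr θ => ?_⟩
  change f r θ + g r θ = _
  rw [hfF r ((inv_anti₀ hm (min_le_left _ _)).trans_lt hr),
    hgG r ((inv_anti₀ hm (min_le_right _ _)).trans_lt hr)]

theorem SmoothAtInfinity.neg (hf : SmoothAtInfinity f) : SmoothAtInfinity fun r θ => -f r θ := by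
  obtain ⟨δ, hδ, F, hF, hfF⟩ := hf
  exact ⟨δ, hδ, fun q => -F q, hF.neg, fun r hr θ => congrArg Neg.neg (hfF r hr θ)⟩

theorem SmoothAtInfinity.const (c : ℝ) : SmoothAtInfinity fun _ _ => c :=
  ⟨1, one_pos, fun _ => c, contDiffOn_const, fun _ _ _ => rfl⟩

theorem SmoothAtInfinity.comp_pi_sub (hf : SmoothAtInfinity f) :
    SmoothAtInfinity fun r θ => f r (Real.pi - θ) := by
  obtain ⟨δ, hδ, F, hF, hfF⟩ := hf
  exact ⟨δ, hδ, fun q => F (q.1, Real.pi - q.2), hF.comp (by fun_prop) fun q hq => ⟨hq.1, trivial⟩,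
    fun r hr θ => hfF r hr _⟩

theorem SmoothAtInfinity.congr (hf : SmoothAtInfinity f) (hfg : ∀ r > 0, ∀ θ, f r θ = g r θ) :
    SmoothAtInfinity g := by
  obtain ⟨δ, hδ, F, hF, hfF⟩ := hf
  exact ⟨δ, hδ, F, hF, fun r hr θ => (hfg r ((inv_pos.2 hδ).trans hr) θ).symm.trans (hfF r hr θ)⟩

theorem SmoothAtInfinity.contDiff_limit (hf : SmoothAtInfinity f) {c : ℝ → ℝ}
    (hc : ∀ θ, Tendsto (fun r => f r θ) atTop (𝓝 (c θ))) : ContDiff ℝ 2 c := by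
  obtain ⟨δ, hδ, F, hF, hF0, -⟩ := hf.exists_extension hc
  obtain rfl : (fun θ => F (0, θ)) = c := funext hF0
  have h1 : ContDiff ℝ (⊤ : ℕ∞) fun θ => F (0, θ) :=
    contDiffOn_univ.1 (hF.comp (f := fun θ : ℝ => ((0 : ℝ), θ)) (by fun_prop)
      fun θ _ => ⟨⟨by simpa using hδ, hδ⟩, trivial⟩)
  exact contDiff_infty.1 h1 2

/-- A function with a smooth expansion without constant term is `O(1/r)`, with radial derivative
`O(1/r²)`. -/
theorem SmoothAtInfinity.exists_bound (hf : SmoothAtInfinity f)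
    (h0 : ∀ θ, Tendsto (fun r => f r θ) atTop (𝓝 0)) :
    ∃ C : ℝ, ∀ᶠ r in atTop, ∀ θ ∈ Icc 0 Real.pi,
      |f r θ| ≤ C * r⁻¹ ∧ |deriv (fun s => f s θ) r| ≤ C * (r ^ 2)⁻¹ := by
  obtain ⟨δ, hδ, F, hF, hF0, hfF⟩ := hf.exists_extension (c := fun _ => 0) h0
  obtain ⟨G, hG, hFG⟩ := exists_smooth_div hF hF0
  -- Halving `δ` and restricting `θ` to `[0, π]` gives a compact part of the strip, on which `G = F
  -- / u` and `∂_u F` are bounded.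
  have hK : IsCompact (Icc 0 (δ / 2) ×ˢ Icc 0 Real.pi) := isCompact_Icc.prod isCompact_Icc
  have hsub : Icc 0 (δ / 2) ×ˢ Icc 0 Real.pi ⊆ strip δ := fun q hq =>
    ⟨⟨by linarith [hq.1.1], by linarith [hq.1.2]⟩, trivial⟩
  obtain ⟨C₁, h1⟩ := hK.exists_bound_of_continuousOn (hG.continuousOn.mono hsub)
  have hFu : ContinuousOn (fun q => fderiv ℝ F q (1, 0)) (strip δ) :=
    (hF.continuousOn_fderiv_of_isOpen (isOpen_strip δ) (by simp)).clm_apply continuousOn_const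
  obtain ⟨C₂, h2⟩ := hK.exists_bound_of_continuousOn (hFu.mono hsub)
  refine ⟨max C₁ C₂, ?_⟩
  filter_upwards [eventually_gt_atTop (δ / 2)⁻¹] with r hr θ hθ
  have hr0 : 0 < r := (inv_pos.2 (half_pos hδ)).trans hr
  have hrδ : δ⁻¹ < r := (inv_anti₀ (half_pos hδ) (half_le_self hδ.le)).trans_lt hr
  have hmem : (r⁻¹, θ) ∈ Icc 0 (δ / 2) ×ˢ Icc 0 Real.pi :=
    ⟨⟨(inv_pos.2 hr0).le, (inv_lt_of_inv_lt₀ (half_pos hδ) hr).le⟩, hθ⟩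
  constructor
  · rw [hfF r hrδ, hFG _ (hsub hmem), abs_mul, abs_of_pos (inv_pos.2 hr0), mul_comm]
    gcongr
    exact (h1 _ hmem).trans (le_max_left _ _)
  · have hd : HasFDerivAt F (fderiv ℝ F (r⁻¹, θ)) (r⁻¹, θ) :=
      ((hF.differentiableOn (by simp)).differentiableAt
        ((isOpen_strip δ).mem_nhds (hsub hmem))).hasFDerivAt
    have h3 := hd.comp_hasDerivAt r ((hasDerivAt_inv hr0.ne').prodMk (hasDerivAt_const r θ))
    have h4 : fderiv ℝ F (r⁻¹, θ) (-(r ^ 2)⁻¹, 0) = -(r ^ 2)⁻¹ * fderiv ℝ F (r⁻¹, θ) (1, 0) := by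
      rw [← smul_eq_mul, ← map_smul]; simp
    have hev : (fun s => f s θ) =ᶠ[𝓝 r] (F ∘ fun s => (s⁻¹, θ)) := by
      filter_upwards [lt_mem_nhds hrδ] with s hs using hfF s hs θ
    rw [(h3.congr_of_eventuallyEq hev).deriv, h4, abs_mul, abs_neg,
      abs_of_pos (inv_pos.2 (pow_pos hr0 2)), mul_comm]
    gcongr
    exact (h2 _ hmem).trans (le_max_right _ _)

end Expansions

/-! ### Leading terms of the wave operator -/

/-- One extra factor `1/r` is moved into the smooth function, where it vanishes at infinity. -/
theorem HasLead.lower {θ₀ : ℝ} {k : ℤ} {f : (Fin 4 → ℝ) → ℝ} {f₀ : ℝ → ℝ}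
    (hf : HasLead θ₀ k f f₀) : HasLead θ₀ (k + 1) f fun _ => 0 := by
  obtain ⟨F, hF, -, hfF⟩ := hf
  refine ⟨fun q => q.1 * F q, contDiffAt_fst.mul hF, by simp, ?_⟩
  filter_upwards [hfF, eventually_fst_pos θ₀] with p h1 hp t φ
  rw [h1, zpow_add_one₀ hp.ne']
  field_simp

theorem HasLead.lead_unique {θ₀ : ℝ} {k : ℤ} {f g : (Fin 4 → ℝ) → ℝ} {f₀ g₀ : ℝ → ℝ}
    (hf : HasLead θ₀ k f f₀) (hg : HasLead θ₀ k g g₀)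
    (hfg : ∀ᶠ r in atTop, f ![0, r, θ₀, 0] = g ![0, r, θ₀, 0]) : f₀ θ₀ = g₀ θ₀ := by
  refine tendsto_nhds_unique ((hf.tendsto 0 0).congr' ?_) (hg.tendsto 0 0)
  filter_upwards [hfg] with r hr
  rw [hr]

theorem HasLead.of_mul_radius_pow {θ₀ : ℝ} (n : ℕ) {f : ℝ → ℝ → ℝ} {f₀ : ℝ → ℝ}
    (hf : HasLead θ₀ 0 (onChart fun r θ => r ^ n * f r θ) f₀) :
    HasLead θ₀ (-n) (onChart f) f₀ := by
  obtain ⟨F, hF, hF0, hfF⟩ := hf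
  refine ⟨F, hF, hF0, ?_⟩
  filter_upwards [hfF, eventually_fst_pos θ₀] with p h1 hp t φ
  have h2 := h1 t φ
  simp only [onChart, Matrix.cons_val_one, Matrix.cons_val_zero, Matrix.cons_val, zpow_zero,
    one_mul] at h2 ⊢
  rw [← h2, zpow_neg, zpow_natCast]
  field_simp

section Lead

variable {h : MetricFunctions} {θ₀ : ℝ}

theorem MetricFunctions.waveOp_eq_pd (h : MetricFunctions) (f : ℝ → ℝ → ℝ) (x : Fin 4 → ℝ) :
    onChart (h.waveOp f) x =
      pd 1 (fun y => onChart h.radialCoeff y * pd 1 (onChart f) y) x * Real.sin (x 2) +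
        pd 2 (fun y => onChart h.angularCoeff y * Real.sin (y 2) * pd 2 (onChart f) y) x := by
  simp [MetricFunctions.waveOp, pd, onChart]

/-- To leading order this is the flat Laplacian times `r² sin θ`, since `N`, `A`, `B` tend to one.
-/
theorem MetricFunctions.hasLead_waveOp (hN : HasLead θ₀ 0 (fun x => h.N (x 1) (x 2)) fun _ => 1)
    (hA : HasLead θ₀ 0 (fun x => h.A (x 1) (x 2)) fun _ => 1)
    (hB : HasLead θ₀ 0 (fun x => h.B (x 1) (x 2)) fun _ => 1) {k : ℤ} {f : ℝ → ℝ → ℝ}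
    {c : ℝ → ℝ} (hf : HasLead θ₀ k (onChart f) c) :
    HasLead θ₀ k (onChart (h.waveOp f)) fun θ =>
      k * (k + 1) * c θ * Real.sin θ + deriv (fun τ => Real.sin τ * deriv c τ) θ := by
  have hrad : HasLead θ₀ 2 (onChart h.radialCoeff) fun _ => 1 :=
    ((hN.mul (MetricFunctions.hasLead_area hB)).mul (hA.inv one_ne_zero)).congr (by norm_num)
      (fun x => by simp only [onChart, MetricFunctions.radialCoeff, div_eq_mul_inv]) (by simp)
  have hang : HasLead θ₀ 0 (onChart h.angularCoeff) fun _ => 1 :=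
    (hN.mul hA).congr (by norm_num) (fun x => rfl) (by simp)
  have h1 := ((hrad.mul (hf.pd 1)).pd 1).mul (HasLead.sin θ₀)
  have h2 := ((hang.mul (HasLead.sin θ₀)).mul (hf.pd 2)).pd 2
  refine ((h1.congr (l := k) (by simp [weight]; ring) (fun _ => rfl) fun _ => rfl).add
    (h2.congr (l := k) (by simp [weight]) (fun _ => rfl) fun _ => rfl)).congr rfl
    (fun x => (h.waveOp_eq_pd f x).symm) fun θ => ?_
  change ((2 + (k + weight 1 - 1) : ℤ) : ℝ) * (1 * (k * c θ)) * Real.sin θ +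
    deriv (fun τ => 1 * Real.sin τ * deriv c τ) θ = _
  rw [show 2 + (k + weight 1 - 1) = k + 1 by simp [weight]; ring]
  push_cast
  simp only [one_mul]
  ring

/-- The `1/r²` coefficient of the wave operator on `1/r`, which carries the mass. -/
theorem MetricFunctions.hasLead_waveOp_inv {M J : ℝ} (hAMC : h.IsAMC M J) (m : ℝ) :
    HasLead θ₀ (-2) (onChart (h.waveOp fun r _ => m / r)) fun θ => -2 * M * m * Real.sin θ := by
  have hA := hAMC.hasLead_A θ₀
  have hB := hAMC.hasLead_B θ₀
  have hone : HasLead θ₀ 0 (fun _ => 1) fun _ => 1 :=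
    ((HasLead.radius θ₀).mul ((HasLead.radius θ₀).inv one_ne_zero)).congr_field
      (by
        filter_upwards [eventually_fst_pos θ₀] with p hp t φ
        simp [hp.ne']) |>.congr (by norm_num) (fun _ => rfl) (by simp)
  have hsub : ∀ (f : ℝ → ℝ → ℝ) (c : ℝ), SmoothAtInfinity f →
      IsBigOInv 2 (fun r θ => f r θ - (1 + c / r)) →
      HasLead θ₀ (-1) (onChart fun r θ => f r θ - 1) fun _ => c := by
    intro f c hf hc
    have hl : ∀ θ, Tendsto (fun r => r * (f r θ + -1)) atTop (𝓝 c) := by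
      intro θ
      have := (hc.tendsto_pow_mul (m := 1) (by norm_num) θ).add_const c
      rw [zero_add] at this
      refine this.congr' ?_
      filter_upwards [eventually_gt_atTop 0] with r hr
      field_simp
      ring
    have hl0 : ∀ θ, Tendsto (fun r => f r θ + -1) atTop (𝓝 0) := by
      intro θ
      have := (hl θ).mul tendsto_inv_atTop_zero
      rw [mul_zero] at this
      refine this.congr' ?_
      filter_upwards [eventually_gt_atTop 0] with r hr
      field_simp
    have h1 := HasLead.of_smoothAtInfinity ((hf.add (SmoothAtInfinity.const (-1))).mul_radius hl0)
      hl θ₀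
    exact HasLead.of_mul_radius_pow 1 (h1.congr rfl
      (fun x => by simp only [onChart, pow_one]; ring) fun _ => rfl)
  have hN1 := hsub h.N (-M) hAMC.smoothN (by
    have := hAMC.expandN
    simpa only [neg_div, ← sub_eq_add_neg] using this)
  have hA1 := hsub h.A M hAMC.smoothA hAMC.expandA
  have hB1 := hsub h.B 0 hAMC.smoothB (by simpa using hAMC.expandB)
  -- `N B²/A - 1 = ((N - 1) B² + (B - 1)(B + 1) - (A - 1)) / A`, whose `1/r` coefficients are `-M`,
  -- `0` and `-M`.
  have hκ : HasLead θ₀ (-1) (onChart fun r θ => h.N r θ * h.B r θ ^ 2 / h.A r θ - 1)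
      fun _ => -2 * M := by
    have h1 := (((hN1.mul (hB.mul hB)).congr (l := -1) (by norm_num) (fun _ => rfl)
      fun _ => rfl).add ((hB1.mul (hB.add hone)).congr (l := -1) (by norm_num) (fun _ => rfl)
      fun _ => rfl)).sub hA1
    refine ((h1.mul (hA.inv one_ne_zero)).congr (l := -1) (g₀ := fun _ => -2 * M) (by norm_num)
      (fun _ => rfl) (fun θ => by ring)).congr_field ?_
    have hA0 : ∀ᶠ p : ℝ × ℝ in atTop ×ˢ 𝓝 θ₀, h.A p.1 p.2 ≠ 0 :=
      (hAMC.tendsto_A.mono_left (Filter.prod_mono le_rfl le_top)).eventually_ne one_ne_zero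
    filter_upwards [hA0] with p hp t φ
    simp only [onChart, Matrix.cons_val_one, Matrix.cons_val_zero, Matrix.cons_val]
    field_simp
    ring
  -- The factor `r²` cancels against `∂_r (m/r) = -m/r²`, so `waveOp` of `m/r` is exactly `-m sin θ
  -- ∂_r (N B²/A)`.
  refine (((hκ.pd 1).mul (HasLead.sin θ₀)).const_mul (-m)).congr (by simp [weight])
    (fun _ => rfl) (fun θ => by simp [leadDeriv]; ring) |>.congr_field ?_
  filter_upwards [eventually_fst_pos θ₀] with p hp t φ
  rw [MetricFunctions.waveOp_eq_pd]
  have hd : ∀ s : ℝ, deriv (fun s => m / s) s = -m / s ^ 2 := fun s => by simp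
  have hev : (fun s => h.radialCoeff s p.2 * deriv (fun s => m / s) s) =ᶠ[𝓝 p.1]
      fun s => -m * (h.N s p.2 * h.B s p.2 ^ 2 / h.A s p.2) := by
    filter_upwards [lt_mem_nhds hp] with s hs
    rw [hd, MetricFunctions.radialCoeff]
    field_simp
  have h0 : ∀ s : ℝ, deriv (fun τ : ℝ => h.angularCoeff p.1 τ * Real.sin τ *
      deriv (fun _ : ℝ => m / p.1) τ) s = 0 := fun s => by simp
  simp only [pd, onChart, update_one, update_two, Matrix.cons_val_one, Matrix.cons_val_zero,
    Matrix.cons_val]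
  rw [hev.deriv_eq, h0, deriv_const_mul_field, deriv_sub_const]
  ring

end Lead

/-! ### Ordinary differential equations on the sphere -/

theorem eq_left_of_hasDerivAt_zero {w w' : ℝ → ℝ} (hw : ∀ x, HasDerivAt w (w' x) x) {a b : ℝ}
    (h0 : ∀ x ∈ Ioo a b, w' x = 0) {x : ℝ} (hx : x ∈ Ioo a b) : w x = w a := by
  obtain ⟨y, hy, hyw⟩ := exists_hasDerivAt_eq_slope w w' hx.1
    (fun y _ => (hw y).continuousAt.continuousWithinAt) fun y _ => hw y
  rw [h0 y ⟨hy.1, hy.2.trans hx.2⟩, eq_comm, div_eq_zero_iff] at hyw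
  rcases hyw with h | h
  · linarith
  · linarith [hx.1]

theorem hasDerivAt_of_contDiff_two {c : ℝ → ℝ} (hc : ContDiff ℝ 2 c) (θ : ℝ) :
    HasDerivAt c (deriv c θ) θ ∧ HasDerivAt (deriv c) (deriv (deriv c) θ) θ := by
  have h1 : ContDiff ℝ (1 + 1) c := by simpa [one_add_one_eq_two] using hc
  exact ⟨(hc.differentiable two_ne_zero θ).hasDerivAt,
    ((contDiff_succ_iff_deriv.1 h1).2.2.differentiable one_ne_zero θ).hasDerivAt⟩

/-- A rotationally symmetric harmonic function on the sphere is constant. -/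
theorem eq_const_of_sphere_harmonic {c : ℝ → ℝ} (hc : ContDiff ℝ 2 c)
    (he : ∀ θ, c (-θ) = c θ) (hp : ∀ θ, c (θ + 2 * Real.pi) = c θ)
    (hode : ∀ θ ∈ Ioo 0 Real.pi, deriv (fun τ => Real.sin τ * deriv c τ) θ = 0) (θ : ℝ) :
    c θ = c 0 := by
  have hd := hasDerivAt_of_contDiff_two hc
  have hw : ∀ x, HasDerivAt (fun τ => Real.sin τ * deriv c τ)
      (deriv (fun τ => Real.sin τ * deriv c τ) x) x := fun x =>
    ((Real.hasDerivAt_sin x).mul (hd x).2).differentiableAt.hasDerivAt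
  have hc0 : ∀ x ∈ Ioo 0 Real.pi, deriv c x = 0 := by
    intro x hx
    have h1 := eq_left_of_hasDerivAt_zero hw hode hx
    simp only [Real.sin_zero, zero_mul] at h1
    exact (mul_eq_zero.1 h1).resolve_left (Real.sin_pos_of_mem_Ioo hx).ne'
  exact eq_of_even_periodic hc.continuous continuous_const he hp (fun _ => rfl) (fun _ => rfl)
    (fun x hx => eq_left_of_hasDerivAt_zero (fun y => (hd y).1) hc0 hx) θ

/-- A rotationally symmetric eigenfunction of degree one on the sphere is a multiple of `cos θ`. -/
theorem eq_cos_of_sphere_eigen {v : ℝ → ℝ} (hv : ContDiff ℝ 2 v)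
    (he : ∀ θ, v (-θ) = v θ) (hp : ∀ θ, v (θ + 2 * Real.pi) = v θ)
    (hode : ∀ θ ∈ Ioo 0 Real.pi,
      2 * v θ * Real.sin θ + deriv (fun τ => Real.sin τ * deriv v τ) θ = 0) (θ : ℝ) :
    v θ = v 0 * Real.cos θ := by
  have hd := hasDerivAt_of_contDiff_two hv
  have hode' : ∀ x ∈ Ioo 0 Real.pi, 2 * v x * Real.sin x +
      (Real.cos x * deriv v x + Real.sin x * deriv (deriv v) x) = 0 := fun x hx => by
    rw [← hode x hx]
    congr 1
    exact ((Real.hasDerivAt_sin x).mul (hd x).2).deriv.symm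
  -- `sin θ` times the Wronskian of `v` with the known solution `cos θ` is constant, and vanishes at
  -- `θ = 0` because `v` is regular on the axis. This excludes the logarithmic second solution.
  have hw : ∀ x, HasDerivAt
      (fun τ => Real.sin τ * (deriv v τ * Real.cos τ + v τ * Real.sin τ)) _ x := fun x =>
    (Real.hasDerivAt_sin x).mul (((hd x).2.mul (Real.hasDerivAt_cos x)).add
      ((hd x).1.mul (Real.hasDerivAt_sin x)))
  have hz : ∀ x ∈ Ioo 0 Real.pi, deriv v x * Real.cos x + v x * Real.sin x = 0 := by
    intro x hx
    have h1 := eq_left_of_hasDerivAt_zero hw (a := 0) (b := Real.pi) (fun y hy => by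
      linear_combination Real.cos y * hode' y hy) hx
    simp only [Real.sin_zero, zero_mul] at h1
    exact (mul_eq_zero.1 h1).resolve_left (Real.sin_pos_of_mem_Ioo hx).ne'
  have hvv : ∀ x ∈ Ioo 0 Real.pi, v x + deriv (deriv v) x = 0 := fun x hx =>
    (mul_eq_zero.1 (by linear_combination hode' x hx - hz x hx :
      Real.sin x * (v x + deriv (deriv v) x) = 0)).resolve_left (Real.sin_pos_of_mem_Ioo hx).ne'
  -- Now `v'' = -v`, and this first integral together with the vanishing Wronskian determines `v`.
  have hq : ∀ x, HasDerivAt (fun τ => v τ * Real.cos τ - deriv v τ * Real.sin τ) _ x := fun x =>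
    ((hd x).1.mul (Real.hasDerivAt_cos x)).sub ((hd x).2.mul (Real.hasDerivAt_sin x))
  refine eq_of_even_periodic (g := fun x => v 0 * Real.cos x) hv.continuous
    (continuous_const.mul Real.continuous_cos) he hp
    (fun x => by rw [Real.cos_neg]) (fun x => by rw [Real.cos_add_two_pi]) (fun x hx => ?_) θ
  have h1 := eq_left_of_hasDerivAt_zero hq (a := 0) (b := Real.pi) (fun y hy => by
      linear_combination -Real.sin y * hvv y hy) hx
  simp only [Real.cos_zero, Real.sin_zero, mul_zero, sub_zero, mul_one] at h1
  linear_combination (-v x) * Real.sin_sq_add_cos_sq x + Real.cos x * h1 + Real.sin x * hz x hx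

/-! ### The homogeneous solution and the scalar hair -/

section Main

variable {h : MetricFunctions} {rH M J : ℝ}

theorem MetricFunctions.waveOp_eq_of_box (h0 : 0 ≤ rH) (hs : h.IsSpacetime rH) {f : ℝ → ℝ → ℝ}
    {S : ℝ} {r θ : ℝ} (hr : rH < r) (hθ : θ ∈ Ioo 0 Real.pi)
    (hbox : box h.metric (onChart f) ![0, r, θ, 0] + S = 0) :
    h.waveOp f r θ = -(h.N r θ * h.A r θ * (r ^ 2 * h.B r θ ^ 2) * Real.sin θ) * S := by
  rw [h.box_onChart h0 hs f 0 0 hr hθ] at hbox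
  have hN := (hs.posN r hr θ).ne'
  have hA := (hs.posA r hr θ).ne'
  have hB := (hs.posB r hr θ).ne'
  have hr0 : r ≠ 0 := (h0.trans_lt hr).ne'
  have hsin := (Real.sin_pos_of_mem_Ioo hθ).ne'
  field_simp at hbox
  linear_combination hbox

/-- A regular solution whose expansion at infinity has no constant term vanishes. -/
theorem MetricFunctions.eq_zero_of_smoothAtInfinity (hs : h.IsSpacetime rH) (hAMC : h.IsAMC M J)
    (hinner : h.IsBlackHole rH ∨ h.IsNeutronStar rH) {χ : ℝ → ℝ → ℝ}
    (hχ : IsRegularOutside rH χ) (hin : h.InnerBounded rH χ)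
    (heq : ∀ r > rH, ∀ θ ∈ Ioo 0 Real.pi, h.waveOp χ r θ = 0) (hsm : SmoothAtInfinity χ)
    (hlim : ∀ θ, Tendsto (fun r => χ r θ) atTop (𝓝 0)) : ∀ r > rH, ∀ θ, χ r θ = 0 := by
  obtain ⟨C, hC⟩ := hin
  obtain ⟨C', hC'⟩ := hsm.exists_bound hlim
  exact eq_zero_of_waveOp_eq_zero hs hAMC hinner hχ heq hC hC'

/-- Expansion coefficients inherit the angular symmetries. The weights `1`, `r`, `r²` cover the
constant term, the monopole and the dipole. -/
theorem limit_even {rH : ℝ} {f : ℝ → ℝ → ℝ} (hf : IsRegularOutside rH f) (w : ℝ → ℝ) (a : ℝ)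
    {c : ℝ → ℝ} (hc : ∀ θ, Tendsto (fun r => w r * (f r θ - a / r)) atTop (𝓝 (c θ))) :
    (∀ θ, c (-θ) = c θ) ∧ ∀ θ, c (θ + 2 * Real.pi) = c θ := by
  refine ⟨fun θ => tendsto_nhds_unique ((hc (-θ)).congr' ?_) (hc θ),
    fun θ => tendsto_nhds_unique ((hc _).congr' ?_) (hc θ)⟩
  · filter_upwards [eventually_gt_atTop rH] with r hr
    rw [hf.even r hr]
  · filter_upwards [eventually_gt_atTop rH] with r hr
    rw [hf.periodic r hr]

/-- The even combination `χ` has no term linear in `r`. Before uniqueness applies, its limit `c` at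
infinity must be shown to vanish. -/
theorem MetricFunctions.IsHomogeneousSolution.comp_pi_sub (hs : h.IsSpacetime rH)
    (hrefl : h.IsReflectionSymmetric rH) (hAMC : h.IsAMC M J)
    (hinner : h.IsBlackHole rH ∨ h.IsNeutronStar rH) {φ₀ : ℝ → ℝ → ℝ}
    (hφ : h.IsHomogeneousSolution rH φ₀) :
    ∀ r > rH, ∀ θ, φ₀ r (Real.pi - θ) = -φ₀ r θ := by
  have h0 := MetricFunctions.inner_nonneg hinner
  have hsym := hrefl.eq_pi_sub h0 hs
  have hreg' := hφ.regular.comp_pi_sub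
  have hb := hφ.inside.innerBounded
  have hw : ∀ r > rH, ∀ θ ∈ Ioo 0 Real.pi, h.waveOp φ₀ r θ = 0 := fun r hr θ hθ => by
    rw [waveOp_eq_of_box h0 hs hr hθ (S := 0) (by rw [hφ.equation 0 0 r hr θ hθ, add_zero]),
      mul_zero]
  obtain ⟨φ₁, hφ₁⟩ := hφ.expand
  set χ : ℝ → ℝ → ℝ := fun r θ => φ₀ r θ + φ₀ r (Real.pi - θ)
  have hχ : IsRegularOutside rH χ := hφ.regular.add hreg'
  have hχw : ∀ r > rH, ∀ θ ∈ Ioo 0 Real.pi, h.waveOp χ r θ = 0 := fun r hr θ hθ => by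
    rw [hs.waveOp_add hφ.regular hreg' hr, waveOp_comp_pi_sub hsym hr, hw r hr θ hθ,
      hw r hr _ ⟨by linarith [hθ.2], by linarith [hθ.1]⟩, add_zero]
  set c : ℝ → ℝ := fun θ => Real.cos θ * φ₁ θ - Real.cos θ * φ₁ (Real.pi - θ)
  have hχlim : ∀ θ, Tendsto (fun r => χ r θ) atTop (𝓝 (c θ)) := by
    intro θ
    have h1 := ((hφ₁.tendsto_pow_mul zero_lt_one θ).add
      (hφ₁.tendsto_pow_mul zero_lt_one (Real.pi - θ))).add_const (c θ)
    rw [add_zero, zero_add] at h1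
    refine h1.congr' ?_
    filter_upwards [eventually_gt_atTop 0] with r hr
    simp only [χ, c, Real.cos_pi_sub]
    field_simp
    ring
  have hχsm : SmoothAtInfinity χ := by
    refine ((hφ.smooth.add hφ.smooth.comp_pi_sub).mul_radius fun θ => ?_).congr fun r hr θ => ?_
    · have := (hχlim θ).mul tendsto_inv_atTop_zero
      rw [mul_zero] at this
      exact this.congr fun r => by simp only [χ]; ring
    · simp only [χ]
      field_simp
  have hcd := hχsm.contDiff_limit hχlim
  obtain ⟨hce, hcp⟩ := limit_even hχ (fun _ => 1) 0 (c := c) (by simpa using hχlim)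
  have hode : ∀ θ ∈ Ioo 0 Real.pi, deriv (fun τ => Real.sin τ * deriv c τ) θ = 0 := by
    intro θ hθ
    have h1 := MetricFunctions.hasLead_waveOp (f := χ) (hAMC.hasLead_N θ) (hAMC.hasLead_A θ) (hAMC.hasLead_B θ)
      (HasLead.of_smoothAtInfinity hχsm hχlim θ)
    have h2 := h1.lead_unique (HasLead.zero θ 0) (by
      filter_upwards [eventually_gt_atTop rH] with r hr using hχw r hr θ hθ)
    simpa using h2
  -- `c` is harmonic on the sphere, hence constant, and contains the factor `cos θ`, which vanishes
  -- at the equator.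
  have hc0 : ∀ θ, c θ = 0 := by
    intro θ
    rw [eq_const_of_sphere_harmonic hcd hce hcp hode θ,
      ← eq_const_of_sphere_harmonic hcd hce hcp hode (Real.pi / 2)]
    simp [c]
  have hz := eq_zero_of_smoothAtInfinity hs hAMC hinner hχ
    (hb.add (hb.comp_pi_sub hsym) hφ.regular hreg') hχw hχsm
    (fun θ => by simpa only [hc0] using hχlim θ)
  intro r hr θ
  linarith [hz r hr θ]

section Scalar

variable {ε : ℝ} {Φ : ℝ → ℝ → ℝ} {μ₁ μ₂ : ℝ → ℝ}

theorem MetricFunctions.IsSGBScalar.tendsto_monopole (hΦ : h.IsSGBScalar rH ε Φ μ₁ μ₂) (θ : ℝ) :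
    Tendsto (fun r => r * Φ r θ) atTop (𝓝 (μ₁ θ)) := by
  have h1 := ((hΦ.expand.tendsto_pow_mul (m := 1) (by norm_num) θ).add_const (μ₁ θ)).add
    (tendsto_inv_atTop_zero.const_mul (μ₂ θ))
  rw [zero_add, mul_zero, add_zero] at h1
  refine h1.congr' ?_
  filter_upwards [eventually_gt_atTop 0] with r hr
  field_simp
  ring

theorem MetricFunctions.IsSGBScalar.tendsto_dipole (hΦ : h.IsSGBScalar rH ε Φ μ₁ μ₂) (θ : ℝ) :
    Tendsto (fun r => r ^ 2 * (Φ r θ - μ₁ θ / r)) atTop (𝓝 (μ₂ θ)) := by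
  have h1 := (hΦ.expand.tendsto_pow_mul (m := 2) (by norm_num) θ).add_const (μ₂ θ)
  rw [zero_add] at h1
  refine h1.congr' ?_
  filter_upwards [eventually_gt_atTop 0] with r hr
  field_simp
  ring

theorem MetricFunctions.IsSGBScalar.tendsto_zero (hΦ : h.IsSGBScalar rH ε Φ μ₁ μ₂) (θ : ℝ) :
    Tendsto (fun r => Φ r θ) atTop (𝓝 0) := by
  have h1 := (hΦ.tendsto_monopole θ).mul tendsto_inv_atTop_zero
  rw [mul_zero] at h1
  refine h1.congr' ?_
  filter_upwards [eventually_gt_atTop 0] with r hr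
  field_simp

/-- The source is even, so it cancels in the difference of `Φ` and its mirror image, for every `ε`;
uniqueness applies to that difference. -/
theorem MetricFunctions.IsSGBScalar.comp_pi_sub (hs : h.IsSpacetime rH)
    (hrefl : h.IsReflectionSymmetric rH) (hAMC : h.IsAMC M J)
    (hinner : h.IsBlackHole rH ∨ h.IsNeutronStar rH) (hΦ : h.IsSGBScalar rH ε Φ μ₁ μ₂) :
    ∀ r > rH, ∀ θ, Φ r (Real.pi - θ) = Φ r θ := by
  have h0 := MetricFunctions.inner_nonneg hinner
  have hsym := hrefl.eq_pi_sub h0 hs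
  have hreg' := hΦ.regular.comp_pi_sub.neg
  have hb := hΦ.inside.innerBounded
  set χ : ℝ → ℝ → ℝ := fun r θ => Φ r θ + -Φ r (Real.pi - θ)
  have hχw : ∀ r > rH, ∀ θ ∈ Ioo 0 Real.pi, h.waveOp χ r θ = 0 := fun r hr θ hθ => by
    have hθ' : Real.pi - θ ∈ Ioo 0 Real.pi := ⟨by linarith [hθ.2], by linarith [hθ.1]⟩
    obtain ⟨eN, eA, eB⟩ := hsym r hr θ
    rw [hs.waveOp_add hΦ.regular hreg' hr, waveOp_neg h (fun r θ => Φ r (Real.pi - θ)),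
      waveOp_comp_pi_sub hsym hr,
      waveOp_eq_of_box h0 hs hr hθ (hΦ.equation 0 0 r hr θ hθ),
      waveOp_eq_of_box h0 hs hr hθ' (hΦ.equation 0 0 r hr _ hθ'),
      gaussBonnet_symm h0 hs hrefl 0 0 hr hθ, eN, eA, eB, Real.sin_pi_sub]
    ring
  have hz := eq_zero_of_smoothAtInfinity hs hAMC hinner (hΦ.regular.add hreg')
    (hb.add (hb.comp_pi_sub hsym).neg hΦ.regular hreg') hχw
    (hΦ.smooth.add hΦ.smooth.comp_pi_sub.neg)
    (fun θ => by simpa using (hΦ.tendsto_zero θ).add (hΦ.tendsto_zero (Real.pi - θ)).neg)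
  intro r hr θ
  have : Φ r θ + -Φ r (Real.pi - θ) = 0 := hz r hr θ
  linarith

/-- The source of the scalar equation does not enter the first two orders. -/
theorem MetricFunctions.IsSGBScalar.hasLead_waveOp (hs : h.IsSpacetime rH) (hAMC : h.IsAMC M J)
    (h0 : 0 ≤ rH) (hΦ : h.IsSGBScalar rH ε Φ μ₁ μ₂) {θ : ℝ} (hθ : θ ∈ Ioo 0 Real.pi) :
    HasLead θ (-2) (onChart (h.waveOp Φ)) fun _ => 0 := by
  have h1 := (((((hAMC.hasLead_N θ).mul (hAMC.hasLead_A θ)).mul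
    (MetricFunctions.hasLead_area (hAMC.hasLead_B θ))).mul (HasLead.sin θ)).mul
    ((hAMC.hasLead_gaussBonnet h0 hs hθ).const_mul ε)).neg.congr (l := -2) (by norm_num)
    (fun _ => rfl) (g₀ := fun _ => 0) (by simp)
  refine h1.congr_field ?_
  filter_upwards [tendsto_fst.eventually (eventually_gt_atTop rH),
    tendsto_snd.eventually (isOpen_Ioo.mem_nhds hθ)] with p hp hpθ t φ
  have hbox := hΦ.equation t φ p.1 hp p.2 hpθ
  -- The wave operator does not depend on `t` and `φ`, so the equation is moved to `t = φ = 0` while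
  -- the source stays at `(t, φ)`.
  have hbox0 := hbox
  rw [h.box_onChart h0 hs Φ t φ hp hpθ, ← h.box_onChart h0 hs Φ 0 0 hp hpθ] at hbox0
  have h2 := waveOp_eq_of_box h0 hs hp hpθ hbox0
  change _ = h.waveOp Φ p.1 p.2
  rw [h2]
  simp only [Matrix.cons_val_one, Matrix.cons_val_zero, Matrix.cons_val]
  ring

/-- At order `r⁻¹` the factor `k(k + 1)` vanishes and only the spherical Laplacian of `μ₁` remains.
-/
theorem MetricFunctions.IsSGBScalar.monopole_const (hs : h.IsSpacetime rH) (hAMC : h.IsAMC M J)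
    (h0 : 0 ≤ rH) (hΦ : h.IsSGBScalar rH ε Φ μ₁ μ₂) (θ : ℝ) : μ₁ θ = μ₁ 0 := by
  have hsm := hΦ.smooth.mul_radius hΦ.tendsto_zero
  obtain ⟨he, hp⟩ := limit_even hΦ.regular (fun r => r) 0 (c := μ₁)
    (by simpa using hΦ.tendsto_monopole)
  refine eq_const_of_sphere_harmonic (hsm.contDiff_limit hΦ.tendsto_monopole) he hp
    (fun τ hτ => ?_) θ
  have h1 : HasLead τ (-1) (onChart Φ) μ₁ := HasLead.of_mul_radius_pow 1
    ((HasLead.of_smoothAtInfinity hsm hΦ.tendsto_monopole τ).congr rfl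
      (fun x => by simp only [onChart, pow_one]) fun _ => rfl)
  have h2 := MetricFunctions.hasLead_waveOp (hAMC.hasLead_N τ) (hAMC.hasLead_A τ)
    (hAMC.hasLead_B τ) h1
  have h3 := h2.lead_unique (hΦ.hasLead_waveOp hs hAMC h0 hτ).lower (Eventually.of_forall
    fun _ => rfl)
  simpa using h3

theorem isRegularOutside_div {rH : ℝ} (h0 : 0 ≤ rH) (m : ℝ) :
    IsRegularOutside rH fun r _ => m / r where
  contDiffOn := contDiffOn_const.div contDiffOn_fst fun _ hp => (h0.trans_lt hp.1).ne'
  even _ _ _ := rfl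
  periodic _ _ _ := rfl

/-- At order `r⁻²` the equation leaves a multiple of `cos θ` undetermined; that freedom is removed
by the evenness of `Φ`, a global fact coming from uniqueness. -/
theorem MetricFunctions.IsSGBScalar.dipole_eq (hs : h.IsSpacetime rH)
    (hrefl : h.IsReflectionSymmetric rH) (hAMC : h.IsAMC M J)
    (hinner : h.IsBlackHole rH ∨ h.IsNeutronStar rH) (hΦ : h.IsSGBScalar rH ε Φ μ₁ μ₂) (θ : ℝ) :
    μ₂ θ = M * μ₁ 0 := by
  have h0 := MetricFunctions.inner_nonneg hinner
  set m := μ₁ 0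
  have hm : ∀ θ, μ₁ θ = m := hΦ.monopole_const hs hAMC h0
  have hsm1 : SmoothAtInfinity fun r θ => r * Φ r θ + -m :=
    (hΦ.smooth.mul_radius hΦ.tendsto_zero).add (SmoothAtInfinity.const (-m))
  have hsm2 := hsm1.mul_radius fun θ => by
    have := (hΦ.tendsto_monopole θ).add_const (-m)
    rwa [hm, add_neg_cancel] at this
  have hlim : ∀ θ, Tendsto (fun r => r ^ 2 * (Φ r θ - m / r)) atTop (𝓝 (μ₂ θ)) := fun θ => by
    simpa only [hm] using hΦ.tendsto_dipole θ
  have hsm : SmoothAtInfinity fun r θ => r ^ 2 * (Φ r θ - m / r) := hsm2.congr fun r hr θ => by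
    field_simp
    ring
  obtain ⟨he, hp⟩ := limit_even hΦ.regular (fun r => r ^ 2) m hlim
  have hcd := hsm.contDiff_limit hlim
  have hμ : ∀ θ, μ₂ (Real.pi - θ) = μ₂ θ := fun θ => by
    refine tendsto_nhds_unique ((hlim _).congr' ?_) (hlim θ)
    filter_upwards [eventually_gt_atTop rH] with r hr
    rw [hΦ.comp_pi_sub hs hrefl hAMC hinner r hr]
  -- Here `k = -2`, so `k(k + 1) = 2`; the right-hand side is minus the mass term of `waveOp` on
  -- `m/r`.
  have hode : ∀ τ ∈ Ioo 0 Real.pi, 2 * μ₂ τ * Real.sin τ +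
      deriv (fun σ => Real.sin σ * deriv μ₂ σ) τ = 2 * M * m * Real.sin τ := by
    intro τ hτ
    have hreg := isRegularOutside_div h0 m
    have h1 : HasLead τ (-2) (onChart fun r θ => Φ r θ + -(m / r)) μ₂ :=
      HasLead.of_mul_radius_pow 2 ((HasLead.of_smoothAtInfinity hsm hlim τ).congr rfl
        (fun x => by simp only [onChart, sub_eq_add_neg]) fun _ => rfl)
    have h2 := MetricFunctions.hasLead_waveOp (hAMC.hasLead_N τ) (hAMC.hasLead_A τ)
      (hAMC.hasLead_B τ) h1
    have h3 := h2.lead_unique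
      ((hΦ.hasLead_waveOp hs hAMC h0 hτ).sub (hasLead_waveOp_inv hAMC m)) (by
        filter_upwards [eventually_gt_atTop rH] with r hr
        change h.waveOp (fun r θ => Φ r θ + -(m / r)) r τ =
          h.waveOp Φ r τ - h.waveOp (fun r _ => m / r) r τ
        rw [hs.waveOp_add hΦ.regular hreg.neg hr, waveOp_neg h fun r _ => m / r]
        ring)
    push_cast at h3
    linear_combination h3
  have hd := fun τ => (hasDerivAt_of_contDiff_two hcd τ).1
  have hderiv : deriv (fun τ => μ₂ τ - M * m) = deriv μ₂ := funext fun τ =>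
    ((hd τ).sub_const _).deriv
  have hcos := eq_cos_of_sphere_eigen (v := fun τ => μ₂ τ - M * m) (hcd.sub contDiff_const)
    (fun τ => by rw [he]) (fun τ => by rw [hp]) (fun τ hτ => by
      rw [hderiv]
      linear_combination hode τ hτ)
  -- `cos` takes opposite values at the two poles, where the even function `μ₂` takes equal ones.
  have hv0 : μ₂ 0 - M * m = 0 := by
    have h1 := hcos Real.pi
    have h2 := hμ 0
    rw [sub_zero] at h2
    simp only [Real.cos_pi, h2] at h1
    linarith
  have h3 := hcos θ
  simp only [hv0, zero_mul] at h3
  linarith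

/-- Legendre orthogonality of degrees zero and one, through the primitive `c sin² θ / 2`. -/
theorem modeOne_const (c : ℝ) : modeOne (fun _ => c) = 0 := by
  have h1 : ∫ θ in (0 : ℝ)..Real.pi, c * Real.cos θ * Real.sin θ = 0 := by
    have hd : ∀ θ ∈ uIcc 0 Real.pi, HasDerivAt (fun θ => c / 2 * Real.sin θ ^ 2)
        (c * Real.cos θ * Real.sin θ) θ := fun θ _ =>
      (((Real.hasDerivAt_sin θ).pow 2).const_mul (c / 2)).congr_deriv (by push_cast; ring)
    rw [intervalIntegral.integral_eq_sub_of_hasDerivAt hd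
      (Continuous.intervalIntegrable (by fun_prop) _ _)]
    simp
  rw [modeOne, h1, mul_zero]

end Scalar

end Main

end SGB

end
theorem mainTheorem6 (h : SGB.MetricFunctions) (rH M J ε : ℝ)
    (hspace : h.IsSpacetime rH)
    (hrefl : h.IsReflectionSymmetric rH)
    (hAMC : h.IsAMC M J)
    (hinner : h.IsBlackHole rH ∨ h.IsNeutronStar rH) :
    -- the Gauss–Bonnet invariant is even under reflection
    (∀ t φ : ℝ, ∀ r > rH, ∀ θ ∈ Set.Ioo 0 Real.pi,
      SGB.gaussBonnet h.metric ![t, r, θ, φ] =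
        SGB.gaussBonnet h.metric ![t, r, Real.pi - θ, φ]) ∧
    -- the homogeneous solution is odd under reflection
    (∀ φ₀ : ℝ → ℝ → ℝ, h.IsHomogeneousSolution rH φ₀ →
      ∀ r > rH, ∀ θ, φ₀ r (Real.pi - θ) = -φ₀ r θ) ∧
    -- the dipole hair has no `ℓ = 1` mode, and the scalar has the stated expansion
    (∀ (Φ : ℝ → ℝ → ℝ) (μ₁ μ₂ : ℝ → ℝ), h.IsSGBScalar rH ε Φ μ₁ μ₂ →
      SGB.modeOne μ₂ = 0 ∧
      ∃ m₁ : ℝ, (∀ θ, μ₁ θ = m₁) ∧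
        (∀ θ, μ₂ θ = M * m₁ + SGB.modeOne μ₂ * Real.cos θ) ∧
        SGB.IsBigOInv 3 fun r θ => Φ r θ - (m₁ / r + M * m₁ / r ^ 2)) := by
  have h0 := SGB.MetricFunctions.inner_nonneg hinner
  refine ⟨fun t φ r hr θ hθ => SGB.MetricFunctions.gaussBonnet_symm h0 hspace hrefl t φ hr hθ,
    fun φ₀ hφ => hφ.comp_pi_sub hspace hrefl hAMC hinner, fun Φ μ₁ μ₂ hΦ => ?_⟩
  have h1 : ∀ θ, μ₁ θ = μ₁ 0 := hΦ.monopole_const hspace hAMC h0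
  have h2 : ∀ θ, μ₂ θ = M * μ₁ 0 := hΦ.dipole_eq hspace hrefl hAMC hinner
  have hmode : SGB.modeOne μ₂ = 0 := by
    rw [show μ₂ = fun _ => M * μ₁ 0 from funext h2, SGB.modeOne_const]
  refine ⟨hmode, μ₁ 0, h1, fun θ => by rw [hmode, zero_mul, add_zero, h2], ?_⟩
  have h3 := hΦ.expand
  simpa only [h1, h2] using h3
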